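/- Let $V$ and $H$ be separable real Hilbert spaces with a dense continuous embedding $V\hookrightarrow H$ (not necessarily compact), let $\|\cdot\|_V$ be the norm of $V$, and let $\langle\cdot,\cdot\rangle$, $\|\cdot\|$ be the scalar product and norm of $H$. Let $a:V\times V\to\mathbb R$ be a symmetric continuous bilinear form and let $\gamma,\nu>0$ be such that $a(v,v)\ge \gamma\|v\|_V^2-\nu\|v\|^2$ for all $v\in V$. Set $\|v\|_a^2:=a(v,v)+\nu\|v\|^2$, and let $\mathcal J(v):=a(v,v)/\|v\|^2$ for $v\neq 0$ and $\mathcal J(0):=+\infty$. Let $\Sigma\subset V$ be a dictionary, i.e. $0\in\Sigma$, $tz\in\Sigma$ for all $z\in\Sigma$ and $t\in\mathbb R$, $\Sigma$ is weakly closed in $V$, and $\mathrm{Span}(\Sigma)$ is dense in $V$. Let $A$ be the self-adjoint operator on $H$ associated with $a$: $D(A)=\{u\in V:\exists f\in H,\ \forall v\in V,\ a(u,v)=\langle f,v\rangle\}$ and $Au=f$. Let $\sigma(A)$ be its spectrum and $\sigma_{\rm ess}(A)$ its essential spectrum, i.e. $\sigma(A)$ without the isolated eigenvalues of finite multiplicity,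 with the convention $\min\emptyset=+\infty$. Assume that $\min\sigma(A)<\min\sigma_{\rm ess}(A)$. Let $u_0\in V$ satisfy $\|u_0\|=1$ and $\min\sigma(A)\le\lambda_0:=a(u_0,u_0)<\min\sigma_{\rm ess}(A)$. Consider the following two algorithms, started at $u_0$. At iteration $n\ge1$, both choose $$z_n\in\operatorname*{argmin}_{z\in\Sigma}\ \tfrac12\|u_{n-1}+z\|_a^2-(\lambda_{n-1}+\nu)\langle u_{n-1},z\rangle .$$ * **PReGA** (Pure Residual Greedy Algorithm): set $u_n:=\dfrac{u_{n-1}+z_n}{\|u_{n-1}+z_n\|}$ and $\lambda_n:=a(u_n,u_n)$. * **OReGA** (Orthogonal Residual Greedy Algorithm): choose $(c_0^{(n)},\dots,c_n^{(n)})\in\operatorname*{argmin}_{c\in\mathbb R^{n+1}}\mathcal J(c_0u_0+c_1z_1+\cdots+c_nz_n)$; set $u_n:=\dfrac{c_0^{(n)}u_0+\cdots+c_n^{(n)}z_n}{\|c_0^{(n)}u_0+\cdots+c_n^{(n)}z_n\|}$; if $\langle u_{n-1},u_n\rangle\le0$, replace $u_n$ by $-u_n$; set $\lambda_n:=a(u_n,u_n)$.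 Then the following properties hold for both algorithms. 1. All the iterations are well-defined: whatever minimizers were chosen before, each minimization problem has at least one solution, and the vectors to be normalized are nonzero. 2. The sequence $(\lambda_n)_{n\in\mathbb N}$ is non-increasing and converges to a limit $\lambda$ that is an eigenvalue of $a$ (there is $\psi\in V$ with $\|\psi\|=1$ and $a(\psi,v)=\lambda\langle\psi,v\rangle$ for all $v\in V$) and satisfies $\lambda<\min\sigma_{\rm ess}(A)$. 3. The sequence $(u_n)_{n\in\mathbb N}$ is bounded in $V$, and any subsequence that converges weakly in $V$ also converges strongly in $V$, to an $H$-normalized eigenvector associated with $\lambda$. Moreover, if $F_\lambda$ denotes the set of $H$-normalized eigenvectors of $a$ associated with $\lambda$, then $$d_a(u_n,F_\lambda):=\inf_{w\in F_\lambda}\|w-u_n\|_a\longrightarrow0 .$$ 4. If $\lambda$ is a simple eigenvalue, there is an $H$-normalized eigenvector $w_\lambda$ associated with $\lambda$ such that the whole sequence $(u_n)_{n\in\mathbb N}$ converges to $w_\lambda$ strongly in $V$. -/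

import Mathlib

open Filter Topology

noncomputable section

namespace GreedyEigen

/-! ### Spectrum, discrete spectrum and essential spectrum of an unbounded real operator -/

section Spectrum

variable {H : Type*} [NormedAddCommGroup H] [InnerProductSpace ℝ H]

/-- The resolvent set of an unbounded operator `A` on `H`: the reals `μ` for which
`A - μ : D(A) → H` is a bijection with bounded inverse `R`. -/
def opResolventSet (A : H →ₗ.[ℝ] H) : Set ℝ :=
  {μ | ∃ R : H →L[ℝ] H,
    (∀ x : A.domain, R (A x - μ • (x : H)) = x) ∧
    (∀ y : H, ∃ x : A.domain, (x : H) = R y ∧ A x - μ • (x : H) = y)}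

/-- The spectrum. For a self-adjoint operator on a real Hilbert space this is the whole spectrum of
(the complexification of) `A`, which is real. -/
def opSpec (A : H →ₗ.[ℝ] H) : Set ℝ := (opResolventSet A)ᶜ

/-- The kernel of `A - μ`, as a subspace of the domain of `A`. -/
def kerSub (A : H →ₗ.[ℝ] H) (μ : ℝ) : Submodule ℝ A.domain :=
  LinearMap.ker (A.toFun - μ • A.domain.subtype)

/-- The discrete spectrum: isolated points of the spectrum that are eigenvalues of finite
multiplicity. -/
def opDiscreteSpec (A : H →ₗ.[ℝ] H) : Set ℝ :=
  {μ | μ ∈ opSpec A ∧ ¬ AccPt μ (𝓟 (opSpec A)) ∧ kerSub A μ ≠ ⊥ ∧ FiniteDimensional ℝ (kerSub A μ)}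

/-- The essential spectrum of a self-adjoint operator: the complement of the discrete spectrum in
the spectrum. -/
def opEssSpec (A : H →ₗ.[ℝ] H) : Set ℝ := opSpec A \ opDiscreteSpec A

/-- The minimum of a closed set of reals that is bounded below, with the convention `min ∅ = +∞`. -/
def minSpec (S : Set ℝ) : EReal := sInf ((fun x : ℝ => (x : EReal)) '' S)

end Spectrum

variable {V H : Type*} [NormedAddCommGroup V] [InnerProductSpace ℝ V]
  [NormedAddCommGroup H] [InnerProductSpace ℝ H]

/-! ### The operator associated with a form -/

/-- The graph of the operator associated with the form `a`: the pairs `(ι u, f)` with `u ∈ V`,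
`f ∈ H` and `a(u, v) = ⟨f, ι v⟩` for all `v ∈ V`. -/
def formGraph (ι : V →L[ℝ] H) (a : V →L[ℝ] V →L[ℝ] ℝ) : Submodule ℝ (H × H) where
  carrier := {p | ∃ u : V, ι u = p.1 ∧ ∀ v : V, a u v = inner ℝ p.2 (ι v)}
  add_mem' := by
    rintro p q ⟨u, hu, hu'⟩ ⟨w, hw, hw'⟩
    exact ⟨u + w, by simp [hu, hw], fun v => by simp [hu', hw', inner_add_left]⟩
  zero_mem' := ⟨0, by simp, fun v => by simp⟩
  smul_mem' := by
    rintro c p ⟨u, hu, hu'⟩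
    exact ⟨c • u, by simp [hu], fun v => by simp [hu', real_inner_smul_left]⟩

/-- The operator `A` on `H` associated with the form `a` with form domain `V`:
`D(A) = {u ∈ V | ∃ f ∈ H, ∀ v ∈ V, a(u, v) = ⟨f, v⟩}` and `A u = f`. -/
def formOperator (ι : V →L[ℝ] H) (a : V →L[ℝ] V →L[ℝ] ℝ) : H →ₗ.[ℝ] H :=
  (formGraph ι a).toLinearPMap

/-- When the embedding is injective with dense range, `formGraph` really is the graph of
`formOperator`. -/
theorem formOperator_graph (ι : V →L[ℝ] H) (hι : Function.Injective ι) (hd : DenseRange ι)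
    (a : V →L[ℝ] V →L[ℝ] ℝ) : (formOperator ι a).graph = formGraph ι a := by
  refine Submodule.toLinearPMap_graph_eq _ ?_
  rintro ⟨x, f⟩ ⟨u, hu, hu'⟩ hx
  simp only at hu hu' hx ⊢
  have hu0 : u = 0 := hι (by rw [hu, hx, map_zero])
  refine hd.eq_zero_of_inner_left (𝕜 := ℝ) ?_
  intro v
  simpa [hu0] using (hu' v).symm

/-! ### Dictionaries -/

/-- A dictionary of `V`: a cone containing `0`, weakly closed, and with dense span. -/
structure IsDictionary (S : Set V) : Prop where
  zero_mem : (0 : V) ∈ S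
  smul_mem : ∀ z ∈ S, ∀ t : ℝ, t • z ∈ S
  weaklyClosed : IsClosed (toWeakSpace ℝ V '' S)
  dense_span : Dense (Submodule.span ℝ S : Set V)

/-! ### The algorithms -/

/-- The norm `‖v‖_a`, where `‖v‖_a ^ 2 = a(v, v) + ν ‖v‖ ^ 2`. -/
def aNorm (ι : V →L[ℝ] H) (a : V →L[ℝ] V →L[ℝ] ℝ) (ν : ℝ) (v : V) : ℝ :=
  Real.sqrt (a v v + ν * ‖ι v‖ ^ 2)

open Classical in
/-- The Rayleigh quotient, equal to `+∞` at `0`. -/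
def rayleigh (ι : V →L[ℝ] H) (a : V →L[ℝ] V →L[ℝ] ℝ) (v : V) : EReal :=
  if v = 0 then ⊤ else ((a v v / ‖ι v‖ ^ 2 : ℝ) : EReal)

/-- `z` is a solution of the residual minimization problem over `S` at the current iterate `u`. -/
def IsResidualMin (ι : V →L[ℝ] H) (a : V →L[ℝ] V →L[ℝ] ℝ) (ν : ℝ) (S : Set V) (u z : V) : Prop :=
  z ∈ S ∧ IsMinOn
    (fun z => (1 / 2) * aNorm ι a ν (u + z) ^ 2 - (a u u + ν) * inner ℝ (ι u) (ι z)) S z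

/-- Normalization in `H`. -/
def hNormalize (ι : V →L[ℝ] H) (v : V) : V := ‖ι v‖⁻¹ • v

/-- The first `N` iterations of the Pure Residual Greedy Algorithm with initial guess `u₀`:
`z n` (for `n ≥ 1`) is the dictionary element selected at iteration `n`, and `u n` the iterate. -/
def IsPReGAUpTo (ι : V →L[ℝ] H) (a : V →L[ℝ] V →L[ℝ] ℝ) (ν : ℝ) (S : Set V) (u₀ : V)
    (N : ℕ) (z u : ℕ → V) : Prop :=
  u 0 = u₀ ∧ ∀ n < N, IsResidualMin ι a ν S (u n) (z (n + 1)) ∧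
    u (n + 1) = hNormalize ι (u n + z (n + 1))

/-- `c₀ u₀ + c₁ z₁ + ⋯ + cₙ zₙ`. -/
def lincomb (u₀ : V) (z : ℕ → V) (n : ℕ) (c : Fin (n + 1) → ℝ) : V :=
  c 0 • u₀ + ∑ k : Fin n, c k.succ • z (k + 1)

/-- `c` minimizes `(c₀, …, cₙ) ↦ 𝒥(c₀ u₀ + c₁ z₁ + ⋯ + cₙ zₙ)` over `ℝ ^ (n + 1)`. -/
def IsRayleighMin (ι : V →L[ℝ] H) (a : V →L[ℝ] V →L[ℝ] ℝ) (u₀ : V) (z : ℕ → V) (n : ℕ)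
    (c : Fin (n + 1) → ℝ) : Prop :=
  IsMinOn (fun c => rayleigh ι a (lincomb u₀ z n c)) Set.univ c

/-- Replace `v` by `-v` if `⟨u, v⟩ ≤ 0`. -/
def orient (ι : V →L[ℝ] H) (u v : V) : V :=
  if inner ℝ (ι u) (ι v) ≤ 0 then -v else v

/-- The first `N` iterations of the Orthogonal Residual Greedy Algorithm with initial guess `u₀`. -/
def IsOReGAUpTo (ι : V →L[ℝ] H) (a : V →L[ℝ] V →L[ℝ] ℝ) (ν : ℝ) (S : Set V) (u₀ : V)
    (N : ℕ) (z u : ℕ → V) : Prop :=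
  u 0 = u₀ ∧ ∀ n < N, IsResidualMin ι a ν S (u n) (z (n + 1)) ∧
    ∃ c : Fin (n + 2) → ℝ, IsRayleighMin ι a u₀ z (n + 1) c ∧
      u (n + 1) = orient ι (u n) (hNormalize ι (lincomb u₀ z (n + 1) c))

/-- All iterations of the PReGA are well defined: after any finite number of iterations (whatever
minimizers were selected) the next minimization problem has a solution, and for every solution
the vector to be normalized is nonzero. -/
def PReGAWellDefined (ι : V →L[ℝ] H) (a : V →L[ℝ] V →L[ℝ] ℝ) (ν : ℝ) (S : Set V) (u₀ : V) : Prop :=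
  ∀ (N : ℕ) (z u : ℕ → V), IsPReGAUpTo ι a ν S u₀ N z u →
    (∃ x, IsResidualMin ι a ν S (u N) x) ∧
    (∀ x, IsResidualMin ι a ν S (u N) x → u N + x ≠ 0)

/-- All iterations of the OReGA are well defined: after any finite number of iterations (whatever
minimizers were selected) the next residual minimization problem has a solution; for every
selected solution `z (N + 1)` the Rayleigh minimization has a solution, and for every such
solution the vector to be normalized is nonzero. -/
def OReGAWellDefined (ι : V →L[ℝ] H) (a : V →L[ℝ] V →L[ℝ] ℝ) (ν : ℝ) (S : Set V) (u₀ : V) : Prop :=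
  ∀ (N : ℕ) (z u : ℕ → V), IsOReGAUpTo ι a ν S u₀ N z u →
    (∃ x, IsResidualMin ι a ν S (u N) x) ∧
    (IsResidualMin ι a ν S (u N) (z (N + 1)) →
      (∃ c, IsRayleighMin ι a u₀ z (N + 1) c) ∧
      (∀ c, IsRayleighMin ι a u₀ z (N + 1) c → lincomb u₀ z (N + 1) c ≠ 0))

/-- `u` is the sequence of iterates of a run of the PReGA. -/
def IsPReGASequence (ι : V →L[ℝ] H) (a : V →L[ℝ] V →L[ℝ] ℝ) (ν : ℝ) (S : Set V) (u₀ : V)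
    (u : ℕ → V) : Prop :=
  ∃ z : ℕ → V, ∀ N, IsPReGAUpTo ι a ν S u₀ N z u

/-- `u` is the sequence of iterates of a run of the OReGA. -/
def IsOReGASequence (ι : V →L[ℝ] H) (a : V →L[ℝ] V →L[ℝ] ℝ) (ν : ℝ) (S : Set V) (u₀ : V)
    (u : ℕ → V) : Prop :=
  ∃ z : ℕ → V, ∀ N, IsOReGAUpTo ι a ν S u₀ N z u

/-! ### Eigenvectors of the form -/

/-- The eigenspace of the form `a` for `μ`: all `w ∈ V` with `a(w, v) = μ ⟨w, v⟩` for all `v`. -/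
def formEigenspace (ι : V →L[ℝ] H) (a : V →L[ℝ] V →L[ℝ] ℝ) (μ : ℝ) : Submodule ℝ V where
  carrier := {w | ∀ v : V, a w v = μ * inner ℝ (ι w) (ι v)}
  add_mem' := by
    intro x y hx hy v
    simp [hx v, hy v, inner_add_left, mul_add]
  zero_mem' := by
    intro v
    simp
  smul_mem' := by
    intro c x hx v
    simp [hx v, real_inner_smul_left, mul_left_comm]

/-- The set `F_μ` of `H`-normalized eigenvectors for `μ`. -/
def normalizedEigenvectors (ι : V →L[ℝ] H) (a : V →L[ℝ] V →L[ℝ] ℝ) (μ : ℝ) : Set V :=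
  {w | w ∈ formEigenspace ι a μ ∧ ‖ι w‖ = 1}

/-- The distance `d_a(v, F) = inf_{w ∈ F} ‖w - v‖_a`, for nonempty `F`. -/
def aDist (ι : V →L[ℝ] H) (a : V →L[ℝ] V →L[ℝ] ℝ) (ν : ℝ) (v : V) (F : Set V) : ℝ :=
  sInf ((fun w => aNorm ι a ν (w - v)) '' F)

/-- `x` converges weakly in `V` to `w`. -/
def WeaklyConverges (x : ℕ → V) (w : V) : Prop :=
  Tendsto (fun k => toWeakSpace ℝ V (x k)) atTop (𝓝 (toWeakSpace ℝ V w))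

/-- The convergence properties of a sequence of iterates `u` with `λ_n = a(u_n, u_n)`, and limit
`l` of the `λ_n`. -/
structure ConvergesToEigenpair (ι : V →L[ℝ] H) (a : V →L[ℝ] V →L[ℝ] ℝ) (ν : ℝ)
    (u : ℕ → V) (l : ℝ) : Prop where
  antitone : Antitone fun n => a (u n) (u n)
  tendsto : Tendsto (fun n => a (u n) (u n)) atTop (𝓝 l)
  eigenvalue : (normalizedEigenvectors ι a l).Nonempty
  below_essential : (l : EReal) < minSpec (opEssSpec (formOperator ι a))
  bounded : ∃ C : ℝ, ∀ n, ‖u n‖ ≤ C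
  subseq : ∀ φ : ℕ → ℕ, StrictMono φ → ∀ w : V, WeaklyConverges (u ∘ φ) w →
    Tendsto (u ∘ φ) atTop (𝓝 w) ∧ w ∈ normalizedEigenvectors ι a l
  dist_tendsto : Tendsto (fun n => aDist ι a ν (u n) (normalizedEigenvectors ι a l)) atTop (𝓝 0)
  simple : Module.finrank ℝ (formEigenspace ι a l) = 1 →
    ∃ w ∈ normalizedEigenvectors ι a l, Tendsto u atTop (𝓝 w)

end GreedyEigen

end

/-!
Write `b(v, w) = a(v, w) + ν ⟨v, w⟩`, an inner product on `V` equivalent to the given one, and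
`r_u(z) = a(u, z) - a(u, u) ⟨u, z⟩` for the residual of a normalized iterate `u`. Up to a constant
the residual minimization problem is that of `b(z, z) / 2 + r_u(z)` over the cone `S`; it is solvable
by weak compactness (`IsGardingForm.exists_isResidualMin`). Optimality along lines of the cone gives
`r_u(z) = -b(z, z)` at a solution `z`, and `r_u(y) ^ 2 ≤ b(z, z) b(y, y)` for every `y` in `S`.

*Energy decrease.* By the first relation, replacing `u` by `u + z` lowers the Rayleigh quotient by at
least `b(z, z) / ‖u + z‖ ^ 2` (`IsResidualDescent.energy_step`). For OReGA, `u + z` is a competitor in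
the Rayleigh minimization, so the same decrease holds for both algorithms. Hence the energies
converge to some `l`, the corrections `z` tend to `0`, and by the second relation and the density of
the span of `S`, the residuals tend to `0` pointwise (`IsResidualDescent.tendsto_residual`). Every
weak limit `w` of a subsequence therefore lies in the eigenspace for `l`.

*Strong convergence.* The embedding of `V` into `H` is not assumed to be compact; what replaces
compactness is that `l` lies below the essential spectrum. The error `e = u - w` satisfies
`b(e, e) = (l + ν) ‖e‖ ^ 2 + o(1)`. On the other hand, apart from finitely many directions in `H`,
`b(e, e) ≥ (m + ν) ‖e‖ ^ 2` for some `m > l` (`IsGardingForm.exists_quartic_bound`), and in these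
directions the weakly null sequence `e` tends to `0`. Thus `‖e‖ → 0`, then `b(e, e) → 0`
(`IsGardingForm.tendsto_of_weaklyConverges`).

*Spectral theory.* The bound in finite codimension is derived from the bounded positive operator
`T = (A + ν)⁻¹`, whose spectral values `t ≥ (m + ν)⁻¹` come from spectral values `t⁻¹ - ν ≤ m` of `A`
and are therefore isolated, of finite multiplicity and finite in number. It rests on two elementary
facts about a bounded symmetric operator. The infimum of its Rayleigh quotient over an invariant
subspace is an approximate eigenvalue (`exists_approx_eigenvalue`); and at an isolated point `M` of
the spectrum `T - M` is bounded below on the orthogonal complement of its kernel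
(`exists_le_norm_of_isolated`). So the supremum of the Rayleigh quotient of `T` over the complement
of the eigenvectors already removed cannot exceed `(m + ν)⁻¹` (`exists_finiteDimensional_le`).

When the eigenvalue is simple there are only two normalized eigenvectors `±w`, and consecutive
iterates have nonnegative inner product from some index on, so the sequence cannot switch between
them (`tendsto_of_tendsto_pair`).
-/

namespace GreedyEigen

/-! ### Bounded symmetric operators: approximate eigenvalues and spectral gaps -/

section Bounded

variable {H : Type*} [NormedAddCommGroup H] [InnerProductSpace ℝ H]

/-- Cauchy–Schwarz for the positive semidefinite form `⟨S x, y⟩` on an invariant subspace `F`. -/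
theorem norm_sq_le_of_nonneg_on (S : H →L[ℝ] H) (hS : ∀ x y, inner ℝ (S x) y = inner ℝ x (S y))
    (F : Submodule ℝ H) (hF : ∀ x ∈ F, S x ∈ F) (hpos : ∀ x ∈ F, 0 ≤ inner ℝ (S x) x)
    {x : H} (hx : x ∈ F) : ‖S x‖ ^ 2 ≤ ‖S‖ * inner ℝ (S x) x := by
  rcases (norm_nonneg S).eq_or_lt' with h0 | h0
  · have : S = 0 := norm_eq_zero.mp h0
    simp [this]
  -- the minimum of `t ↦ ⟨S (x + t S x), x + t S x⟩` is nearly reached at `t = -1 / ‖S‖`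
  have h1 := hpos (x - ‖S‖⁻¹ • S x) (F.sub_mem hx (F.smul_mem _ (hF x hx)))
  have h2 : inner ℝ (S (S x)) (S x) ≤ ‖S‖ * ‖S x‖ ^ 2 := by
    calc inner ℝ (S (S x)) (S x) ≤ ‖S (S x)‖ * ‖S x‖ := real_inner_le_norm _ _
      _ ≤ (‖S‖ * ‖S x‖) * ‖S x‖ := by gcongr; exact S.le_opNorm _
      _ = _ := by ring
  simp only [map_sub, map_smul, inner_sub_left, inner_sub_right, real_inner_smul_left,
    real_inner_smul_right, real_inner_self_eq_norm_sq] at h1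
  rw [hS (S x) x, real_inner_self_eq_norm_sq] at h1
  have h3 : ‖S‖ * (inner ℝ (S x) x - ‖S‖⁻¹ * ‖S x‖ ^ 2 -
      (‖S‖⁻¹ * ‖S x‖ ^ 2 - ‖S‖⁻¹ * (‖S‖⁻¹ * inner ℝ (S (S x)) (S x)))) =
      ‖S‖ * inner ℝ (S x) x - 2 * ‖S x‖ ^ 2 + ‖S‖⁻¹ * inner ℝ (S (S x)) (S x) := by
    field_simp
    ring
  have h4 := mul_nonneg h0.le h1
  have h5 : ‖S‖⁻¹ * inner ℝ (S (S x)) (S x) ≤ ‖S x‖ ^ 2 := by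
    rw [inv_mul_le_iff₀ h0]; exact h2
  linarith

/-- The infimum `m` of the Rayleigh quotient of `S` over an invariant subspace is an approximate
eigenvalue: `S - m` is not bounded below on that subspace. -/
theorem exists_approx_eigenvalue (S : H →L[ℝ] H)
    (hS : ∀ x y, inner ℝ (S x) y = inner ℝ x (S y)) (F : Submodule ℝ H) (hF : ∀ x ∈ F, S x ∈ F)
    {c : ℝ} (hc : ∃ x ∈ F, inner ℝ (S x) x < c * ‖x‖ ^ 2) :
    ∃ m < c, (∀ m', (∀ x ∈ F, m' * ‖x‖ ^ 2 ≤ inner ℝ (S x) x) → m' ≤ m) ∧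
      ∀ ε > 0, ∃ x ∈ F, x ≠ 0 ∧ ‖S x - m • x‖ < ε * ‖x‖ := by
  set B : Set ℝ := {m | ∀ x ∈ F, m * ‖x‖ ^ 2 ≤ inner ℝ (S x) x} with hB
  obtain ⟨x₀, hx₀, hlt⟩ := hc
  have hx₀0 : 0 < ‖x₀‖ ^ 2 := by
    have : x₀ ≠ 0 := by rintro rfl; simp at hlt
    positivity
  set q : ℝ := inner ℝ (S x₀) x₀ / ‖x₀‖ ^ 2 with hq
  have hqc : q < c := by rw [hq, div_lt_iff₀ hx₀0]; exact hlt
  have hub : ∀ m ∈ B, m ≤ q := fun m hm => by rw [hq, le_div_iff₀ hx₀0]; exact hm x₀ hx₀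
  have hbdd : BddAbove B := ⟨q, hub⟩
  have hne : B.Nonempty := by
    refine ⟨-‖S‖, fun x _ => ?_⟩
    have h1 := abs_le.mp (abs_real_inner_le_norm (S x) x)
    have h2 : ‖S x‖ * ‖x‖ ≤ ‖S‖ * ‖x‖ ^ 2 := by
      nlinarith [S.le_opNorm x, norm_nonneg x]
    linarith [h1.1]
  have hmem : sSup B ∈ B := by
    have hcl : IsClosed B := by
      have : B = ⋂ x ∈ F, {m : ℝ | m * ‖x‖ ^ 2 ≤ inner ℝ (S x) x} := by ext; simp [hB]
      rw [this]
      exact isClosed_biInter fun x _ => isClosed_le (by fun_prop) (by fun_prop)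
    exact hcl.csSup_mem hne hbdd
  refine ⟨sSup B, (csSup_le hne hub).trans_lt hqc, fun m' hm' => le_csSup hbdd hm', ?_⟩
  intro ε hε
  set m := sSup B with hm
  set N : H →L[ℝ] H := S - m • ContinuousLinearMap.id ℝ H with hN
  have hNx : ∀ x, N x = S x - m • x := fun x => by simp [hN]
  have hNi : ∀ x, inner ℝ (N x) x = inner ℝ (S x) x - m * ‖x‖ ^ 2 := fun x => by
    rw [hNx, inner_sub_left, real_inner_smul_left, real_inner_self_eq_norm_sq]
  set η : ℝ := ε ^ 2 / (‖N‖ + 1) with hη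
  have hη0 : 0 < η := by positivity
  have : ¬ (m + η ∈ B) := fun h => by linarith [le_csSup hbdd h]
  simp only [hB, Set.mem_ofPred_eq, not_forall, not_le] at this
  obtain ⟨x, hx, hxlt⟩ := this
  have hx0 : x ≠ 0 := by rintro rfl; simp at hxlt
  refine ⟨x, hx, hx0, ?_⟩
  have hxn : 0 < ‖x‖ := norm_pos_iff.mpr hx0
  have h1 : ‖N x‖ ^ 2 ≤ ‖N‖ * inner ℝ (N x) x := by
    refine norm_sq_le_of_nonneg_on N (fun x y => ?_) F (fun x hx => ?_) (fun x hx => ?_) hx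
    · simp only [hNx, inner_sub_left, inner_sub_right, real_inner_smul_left,
        real_inner_smul_right, hS]
    · rw [hNx]; exact F.sub_mem (hF x hx) (F.smul_mem _ hx)
    · rw [hNi]; linarith [hmem x hx]
  have h2 : inner ℝ (N x) x < η * ‖x‖ ^ 2 := by rw [hNi]; linarith
  have h3 : 0 ≤ inner ℝ (N x) x := by rw [hNi]; linarith [hmem x hx]
  have h4 : ‖N x‖ ^ 2 < (ε * ‖x‖) ^ 2 := by
    calc ‖N x‖ ^ 2 ≤ ‖N‖ * inner ℝ (N x) x := h1
      _ ≤ (‖N‖ + 1) * inner ℝ (N x) x := by gcongr; linarith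
      _ < (‖N‖ + 1) * (η * ‖x‖ ^ 2) := by gcongr
      _ = (ε * ‖x‖) ^ 2 := by rw [hη]; field_simp
  rw [← hNx]
  exact lt_of_pow_lt_pow_left₀ 2 (by positivity) h4

theorem mem_spectrum_of_approx (S : H →L[ℝ] H) {m : ℝ}
    (h : ∀ ε > 0, ∃ x : H, x ≠ 0 ∧ ‖S x - m • x‖ < ε * ‖x‖) : m ∈ spectrum ℝ S := by
  rw [spectrum.mem_iff]
  rintro ⟨U, hU⟩
  set R : H →L[ℝ] H := ↑U⁻¹ with hR
  obtain ⟨x, hx0, hx⟩ := h (1 / (‖R‖ + 1)) (by positivity)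
  have h1 : R ((U : H →L[ℝ] H) x) = x := by
    rw [← mul_apply_eq_comp, hR, Units.inv_mul, one_apply_eq_self]
  have h2 : (U : H →L[ℝ] H) x = -(S x - m • x) := by
    rw [hU]; simp [Algebra.algebraMap_eq_smul_one]
  have h3 : ‖x‖ ≤ ‖R‖ * ‖S x - m • x‖ := by
    calc ‖x‖ = ‖R ((U : H →L[ℝ] H) x)‖ := by rw [h1]
      _ ≤ ‖R‖ * ‖(U : H →L[ℝ] H) x‖ := R.le_opNorm _
      _ = _ := by rw [h2, norm_neg]
  have hxn : 0 < ‖x‖ := norm_pos_iff.mpr hx0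
  have h4 : ‖R‖ * ‖S x - m • x‖ ≤ ‖R‖ * (1 / (‖R‖ + 1) * ‖x‖) := by gcongr
  have h5 : ‖R‖ * (1 / (‖R‖ + 1) * ‖x‖) < ‖x‖ := by
    rw [← mul_assoc, mul_one_div]
    have : ‖R‖ / (‖R‖ + 1) < 1 := by rw [div_lt_one (by positivity)]; linarith
    nlinarith
  linarith

/-- Spectral mapping for `N ^ 2`, where `N = S - c`, in the form needed here. -/
theorem sq_notMem_spectrum (S : H →L[ℝ] H) {c ρ : ℝ} (h1 : c + ρ ∉ spectrum ℝ S)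
    (h2 : c - ρ ∉ spectrum ℝ S) :
    ρ ^ 2 ∉ spectrum ℝ ((S - c • (1 : H →L[ℝ] H)) * (S - c • (1 : H →L[ℝ] H))) := by
  rw [spectrum.notMem_iff] at *
  have := (h1.mul h2).neg
  convert this using 1
  ext x
  simp only [Algebra.algebraMap_eq_smul_one, mul_apply_eq_comp,
    sub_apply, smul_apply, one_apply_eq_self,
    neg_apply, map_sub, map_smul]
  module

/-- If `S` is symmetric and `(c - r, c + r)` contains no point of its spectrum, then
`‖(S - c) x‖ ≥ r ‖x‖`. -/
theorem le_norm_sub_of_gap (S : H →L[ℝ] H) (hS : ∀ x y, inner ℝ (S x) y = inner ℝ x (S y))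
    {c r : ℝ} (hr : 0 < r) (hgap : ∀ t, |t - c| < r → t ∉ spectrum ℝ S) (x : H) :
    r * ‖x‖ ≤ ‖S x - c • x‖ := by
  by_contra! hlt
  set N : H →L[ℝ] H := S - c • (1 : H →L[ℝ] H) with hN
  have hNx : ∀ x, N x = S x - c • x := fun x => by simp [hN]
  have hNs : ∀ x y, inner ℝ (N x) y = inner ℝ x (N y) := fun x y => by
    simp only [hNx, inner_sub_left, inner_sub_right, real_inner_smul_left,
      real_inner_smul_right, hS]
  have hNN : ∀ x, inner ℝ ((N * N) x) x = ‖N x‖ ^ 2 := fun x => by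
    rw [mul_apply_eq_comp, hNs, real_inner_self_eq_norm_sq]
  obtain ⟨m, hmr, hm0, hm⟩ := exists_approx_eigenvalue (N * N)
    (fun x y => by simp only [mul_apply_eq_comp, hNs]) ⊤ (fun _ _ => trivial)
    (c := r ^ 2) ⟨x, trivial, by
      rw [hNN, hNx, ← mul_pow]
      exact pow_lt_pow_left₀ hlt (norm_nonneg _) two_ne_zero⟩
  have hm0 : 0 ≤ m := hm0 0 fun x _ => by rw [hNN, zero_mul]; positivity
  have hs : √m < r := by rw [Real.sqrt_lt' hr]; exact hmr
  have hs0 : |√m| = √m := abs_of_nonneg (Real.sqrt_nonneg m)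
  refine sq_notMem_spectrum S (c := c) (ρ := √m)
    (hgap _ (by simpa [hs0] using hs)) (hgap _ (by simpa [hs0] using hs)) ?_
  rw [Real.sq_sqrt hm0]
  exact mem_spectrum_of_approx _ fun ε hε => by
    obtain ⟨x, -, hx⟩ := hm ε hε
    exact ⟨x, hx⟩

theorem isolated_of_not_accPt {s : Set ℝ} {M : ℝ} (h : ¬ AccPt M (𝓟 s)) :
    ∃ δ > 0, ∀ t ∈ s, |t - M| < δ → t = M := by
  rw [accPt_iff_nhds] at h
  push Not at h
  obtain ⟨U, hU, h⟩ := h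
  obtain ⟨δ, hδ, hball⟩ := Metric.mem_nhds_iff.mp hU
  exact ⟨δ, hδ, fun t ht hd => h t ⟨hball (by rwa [Metric.mem_ball, Real.dist_eq]), ht⟩⟩

/-- At an isolated point `M` of the spectrum, `T - M` is bounded below on the orthogonal complement
of its kernel. -/
theorem exists_le_norm_of_isolated [CompleteSpace H] (T : H →L[ℝ] H)
    (hT : ∀ x y, inner ℝ (T x) y = inner ℝ x (T y)) {M : ℝ}
    (hM : ¬ AccPt M (𝓟 (spectrum ℝ T))) :
    ∃ d > 0, ∀ x ∈ (Module.End.eigenspace (T : H →ₗ[ℝ] H) M)ᗮ, d * ‖x‖ ≤ ‖T x - M • x‖ := by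
  obtain ⟨δ, hδ, hiso⟩ := isolated_of_not_accPt hM
  set N : H →L[ℝ] H := T - M • (1 : H →L[ℝ] H) with hN
  have hNx : ∀ x, N x = T x - M • x := fun x => by simp [hN]
  have hNs : ∀ x y, inner ℝ (N x) y = inner ℝ x (N y) := fun x y => by
    simp only [hNx, inner_sub_left, inner_sub_right, real_inner_smul_left,
      real_inner_smul_right, hT]
  -- the spectrum of `N ^ 2` does not meet `(0, δ ^ 2)`
  have hgap : ∀ t, |t - δ ^ 2 / 2| < δ ^ 2 / 2 → t ∉ spectrum ℝ (N * N) := by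
    intro t ht
    rw [abs_lt] at ht
    have ht0 : 0 < t := by linarith
    have hs : √t < δ := by rw [Real.sqrt_lt' hδ]; linarith
    have hs0 : 0 < √t := Real.sqrt_pos.mpr ht0
    rw [← Real.sq_sqrt ht0.le]
    refine sq_notMem_spectrum T (fun h => ?_) (fun h => ?_)
    · have := hiso _ h (by simpa [abs_of_pos hs0] using hs)
      linarith
    · have := hiso _ h (by simpa [abs_of_pos hs0] using hs)
      linarith
  -- hence `N` is bounded below by `δ` on its own range
  have hrange : ∀ x, δ * ‖N x‖ ≤ ‖N (N x)‖ := by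
    intro x
    have h1 := le_norm_sub_of_gap (N * N)
      (fun x y => by simp only [mul_apply_eq_comp, hNs]) (by positivity) hgap x
    have h2 := pow_le_pow_left₀ (by positivity) h1 2
    rw [@norm_sub_sq_real, real_inner_smul_right, mul_apply_eq_comp, hNs (N x) x,
      real_inner_self_eq_norm_sq, norm_smul, mul_pow, mul_pow, Real.norm_eq_abs, sq_abs] at h2
    have h3 : (δ * ‖N x‖) ^ 2 ≤ ‖N (N x)‖ ^ 2 := by linarith
    exact le_of_sq_le_sq h3 (norm_nonneg _)
  refine ⟨δ, hδ, fun x hx => ?_⟩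
  have hsa : IsSelfAdjoint N := by
    rw [ContinuousLinearMap.isSelfAdjoint_iff_isSymmetric]
    exact hNs
  have hker : Module.End.eigenspace (T : H →ₗ[ℝ] H) M = (N : H →ₗ[ℝ] H).ker := by
    ext y
    simp [hNx, sub_eq_zero]
  rw [hker, ContinuousLinearMap.orthogonal_ker, hsa.adjoint_eq] at hx
  have hcl : IsClosed {y : H | δ * ‖y‖ ≤ ‖N y‖} := isClosed_le (by fun_prop) (by fun_prop)
  have hsub : closure ((N : H →ₗ[ℝ] H).range : Set H) ⊆ {y : H | δ * ‖y‖ ≤ ‖N y‖} := by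
    refine closure_minimal ?_ hcl
    rintro _ ⟨y, rfl⟩
    exact hrange y
  rw [← hNx]
  exact hsub hx

/-- If the spectrum of a symmetric bounded operator above the level `k` consists of isolated
eigenvalues of finite multiplicity, then up to a finite dimensional invariant subspace the
operator is bounded above by `k`. -/
theorem exists_finiteDimensional_le [CompleteSpace H] (T : H →L[ℝ] H)
    (hT : ∀ x y, inner ℝ (T x) y = inner ℝ x (T y)) {k : ℝ}
    (h : ∀ t ∈ spectrum ℝ T, k ≤ t → ¬ AccPt t (𝓟 (spectrum ℝ T)) ∧
      FiniteDimensional ℝ (Module.End.eigenspace (T : H →ₗ[ℝ] H) t)) :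
    ∃ E : Submodule ℝ H, FiniteDimensional ℝ E ∧ (∀ x ∈ E, T x ∈ E) ∧
      ∀ x ∈ Eᗮ, inner ℝ (T x) x ≤ k * ‖x‖ ^ 2 := by
  set Λ : Set ℝ := spectrum ℝ T ∩ Set.Ici k with hΛ
  have hcomp : IsCompact Λ := (spectrum.isCompact T).inter_right isClosed_Ici
  have hfin : Λ.Finite := by
    by_contra hinf
    obtain ⟨t, ht, hacc⟩ := Set.Infinite.exists_accPt_of_subset_isCompact hinf hcomp subset_rfl
    exact (h t ht.1 ht.2).1 (hacc.mono (principal_mono.mpr Set.inter_subset_left))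
  set E : Submodule ℝ H := ⨆ t : Λ, Module.End.eigenspace (T : H →ₗ[ℝ] H) t with hE
  have hEinv : ∀ x ∈ E, T x ∈ E := by
    intro x hx
    induction hx using Submodule.iSup_induction' with
    | mem t x hx =>
      have : T x = (t : ℝ) • x := Module.End.mem_eigenspace_iff.mp hx
      rw [this]
      exact E.smul_mem _ (Submodule.mem_iSup_of_mem t hx)
    | zero => simp
    | add x y _ _ hx hy => rw [map_add]; exact E.add_mem hx hy
  refine ⟨E, ?_, hEinv, ?_⟩
  · have : Finite Λ := hfin
    have : ∀ t : Λ, FiniteDimensional ℝ (Module.End.eigenspace (T : H →ₗ[ℝ] H) (t : ℝ)) :=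
      fun t => (h t t.2.1 t.2.2).2
    exact Submodule.finite_iSup _
  by_contra! hcon
  obtain ⟨x, hx, hlt⟩ := hcon
  obtain ⟨m, hmk, -, hm⟩ := exists_approx_eigenvalue (-T) (fun x y => by simp [hT]) Eᗮ
    (fun x hx => by
      rw [Submodule.mem_orthogonal] at hx ⊢
      intro e he
      rw [neg_apply, inner_neg_right, ← hT, hx _ (hEinv e he), neg_zero])
    (c := -k) ⟨x, hx, by simpa using hlt⟩
  have hm' : ∀ ε > 0, ∃ x ∈ Eᗮ, x ≠ 0 ∧ ‖T x - (-m) • x‖ < ε * ‖x‖ := by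
    intro ε hε
    obtain ⟨x, hx, hx0, hlt⟩ := hm ε hε
    refine ⟨x, hx, hx0, ?_⟩
    rwa [← norm_neg, show -(T x - (-m) • x) = (-T) x - m • x by
      rw [neg_apply]; module]
  have hspec : -m ∈ spectrum ℝ T := mem_spectrum_of_approx T fun ε hε => by
    obtain ⟨x, -, hx⟩ := hm' ε hε
    exact ⟨x, hx⟩
  have hkm : k ≤ -m := by linarith
  obtain ⟨d, hd, hlow⟩ := exists_le_norm_of_isolated T hT (h _ hspec hkm).1
  obtain ⟨y, hy, -, hylt⟩ := hm' d hd
  have hle : Module.End.eigenspace (T : H →ₗ[ℝ] H) (-m) ≤ E :=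
    le_iSup (fun t : Λ => Module.End.eigenspace (T : H →ₗ[ℝ] H) (t : ℝ)) ⟨-m, hspec, hkm⟩
  linarith [hlow y (Submodule.orthogonal_le hle hy)]

end Bounded

/-! ### The shifted form and the resolvent of the associated operator -/

section Form

variable {V H : Type*} [NormedAddCommGroup V] [InnerProductSpace ℝ V]
  [NormedAddCommGroup H] [InnerProductSpace ℝ H]

/-- The shifted form `b(v, w) = a(v, w) + ν ⟨v, w⟩`, the inner product whose norm is `‖·‖_a`. -/
noncomputable def shiftedForm (ι : V →L[ℝ] H) (a : V →L[ℝ] V →L[ℝ] ℝ) (ν : ℝ) :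
    V →L[ℝ] V →L[ℝ] ℝ :=
  a + ν • ((innerₗ H).mkContinuous₂ 1 fun x y => by
    simpa using abs_real_inner_le_norm x y).bilinearComp ι ι

@[simp]
theorem shiftedForm_apply (ι : V →L[ℝ] H) (a : V →L[ℝ] V →L[ℝ] ℝ) (ν : ℝ) (v w : V) :
    shiftedForm ι a ν v w = a v w + ν * inner ℝ (ι v) (ι w) := by
  simp [shiftedForm]

/-- A symmetric form satisfying the Gårding inequality `a(v, v) ≥ γ ‖v‖_V ^ 2 - ν ‖v‖ ^ 2`. -/
structure IsGardingForm (ι : V →L[ℝ] H) (a : V →L[ℝ] V →L[ℝ] ℝ) (γ ν : ℝ) : Prop where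
  symm : ∀ v w, a v w = a w v
  gamma_pos : 0 < γ
  garding : ∀ v, γ * ‖v‖ ^ 2 - ν * ‖ι v‖ ^ 2 ≤ a v v

namespace IsGardingForm

variable {ι : V →L[ℝ] H} {a : V →L[ℝ] V →L[ℝ] ℝ} {γ ν : ℝ}

theorem coercive (h : IsGardingForm ι a γ ν) (v : V) :
    γ * ‖v‖ ^ 2 ≤ shiftedForm ι a ν v v := by
  rw [shiftedForm_apply, real_inner_self_eq_norm_sq]
  linarith [h.garding v]

theorem shiftedForm_symm (h : IsGardingForm ι a γ ν) (v w : V) :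
    shiftedForm ι a ν v w = shiftedForm ι a ν w v := by
  simp only [shiftedForm_apply, h.symm v w, real_inner_comm]

theorem shiftedForm_nonneg (h : IsGardingForm ι a γ ν) (v : V) :
    0 ≤ shiftedForm ι a ν v v :=
  le_trans (mul_nonneg h.gamma_pos.le (sq_nonneg _)) (h.coercive v)

theorem eq_zero_of_shiftedForm (h : IsGardingForm ι a γ ν) {v : V}
    (hv : shiftedForm ι a ν v v ≤ 0) : v = 0 := by
  have h1 := h.coercive v
  have h2 : ‖v‖ ^ 2 ≤ 0 := by
    by_contra! hpos
    nlinarith [mul_pos h.gamma_pos hpos]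
  exact norm_eq_zero.mp (pow_eq_zero_iff two_ne_zero |>.mp (le_antisymm h2 (sq_nonneg _)))

theorem cauchy_schwarz (h : IsGardingForm ι a γ ν) (v w : V) :
    shiftedForm ι a ν v w ^ 2 ≤ shiftedForm ι a ν v v * shiftedForm ι a ν w w := by
  have h1 := LinearMap.BilinForm.apply_sq_le_of_symm
    (B := (shiftedForm ι a ν).toLinearMap₁₂) (fun v => h.shiftedForm_nonneg v)
    ⟨fun v w => h.shiftedForm_symm v w⟩ v w
  simpa using h1

theorem aNorm_sq (h : IsGardingForm ι a γ ν) (v : V) :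
    aNorm ι a ν v ^ 2 = shiftedForm ι a ν v v := by
  have h1 := h.shiftedForm_nonneg v
  rw [shiftedForm_apply, real_inner_self_eq_norm_sq] at *
  rw [aNorm, Real.sq_sqrt h1]

/-- The solution operator of the coercive problem `b(u, w) = ⟨f, w⟩` (Lax–Milgram). -/
theorem exists_solutionOperator [CompleteSpace V] [CompleteSpace H]
    (h : IsGardingForm ι a γ ν) :
    ∃ L : H →L[ℝ] V, ∀ f w, shiftedForm ι a ν (L f) w = inner ℝ f (ι w) := by
  have hc : IsCoercive (shiftedForm ι a ν) :=
    ⟨γ, h.gamma_pos, fun v => by linarith [h.coercive v, sq ‖v‖]⟩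
  refine ⟨(hc.continuousLinearEquivOfBilin.symm : V →L[ℝ] V) ∘L ContinuousLinearMap.adjoint ι,
    fun f w => ?_⟩
  rw [← hc.continuousLinearEquivOfBilin_apply]
  simp [ContinuousLinearMap.adjoint_inner_left]

theorem solutionOperator_unique (h : IsGardingForm ι a γ ν) {L : H →L[ℝ] V}
    (hL : ∀ f w, shiftedForm ι a ν (L f) w = inner ℝ f (ι w)) {f : H} {u : V}
    (hu : ∀ w, shiftedForm ι a ν u w = inner ℝ f (ι w)) : L f = u := by
  refine sub_eq_zero.mp (h.eq_zero_of_shiftedForm (le_of_eq ?_))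
  have h1 : ∀ w, shiftedForm ι a ν (L f - u) w = 0 := fun w => by
    rw [map_sub, sub_apply, hL, hu, sub_self]
  exact h1 _

theorem resolvent_symm (h : IsGardingForm ι a γ ν) {L : H →L[ℝ] V}
    (hL : ∀ f w, shiftedForm ι a ν (L f) w = inner ℝ f (ι w)) (x y : H) :
    inner ℝ ((ι ∘L L) x) y = inner ℝ x ((ι ∘L L) y) := by
  simp only [ContinuousLinearMap.comp_apply]
  rw [← hL, real_inner_comm, ← hL, h.shiftedForm_symm]

/-- The defining relation of `A`, in terms of `T = (A + ν)⁻¹`. -/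
theorem resolvent_apply_eq (h : IsGardingForm ι a γ ν) (hι : Function.Injective ι)
    (hd : DenseRange ι) {L : H →L[ℝ] V}
    (hL : ∀ f w, shiftedForm ι a ν (L f) w = inner ℝ f (ι w)) (x : (formOperator ι a).domain) :
    ι (L (formOperator ι a x + ν • (x : H))) = x := by
  have hx : ((x : H), formOperator ι a x) ∈ (formOperator ι a).graph :=
    (formOperator ι a).mem_graph x
  rw [formOperator_graph ι hι hd a] at hx
  obtain ⟨u, hu, hu'⟩ := hx
  have hu'' : ι u = x := hu
  rw [h.solutionOperator_unique hL (u := u), hu'']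
  intro w
  rw [shiftedForm_apply, hu', inner_add_left, real_inner_smul_left, hu'']

theorem exists_domain_eq_resolvent (hι : Function.Injective ι)
    (hd : DenseRange ι) {L : H →L[ℝ] V}
    (hL : ∀ f w, shiftedForm ι a ν (L f) w = inner ℝ f (ι w)) (f : H) :
    ∃ x : (formOperator ι a).domain, (x : H) = ι (L f) ∧
      formOperator ι a x = f - ν • ι (L f) := by
  have hx : (ι (L f), f - ν • ι (L f)) ∈ formGraph ι a := by
    refine ⟨L f, rfl, fun v => ?_⟩
    have := hL f v
    rw [shiftedForm_apply] at this
    simp only [inner_sub_left, real_inner_smul_left]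
    linarith
  rw [← formOperator_graph ι hι hd a, LinearPMap.mem_graph_iff] at hx
  exact hx

/-- If `μ` is in the resolvent set of `A`, then `(μ + ν)⁻¹` is in that of `T = (A + ν)⁻¹`. -/
theorem inv_notMem_spectrum (h : IsGardingForm ι a γ ν) (hι : Function.Injective ι)
    (hd : DenseRange ι) {L : H →L[ℝ] V}
    (hL : ∀ f w, shiftedForm ι a ν (L f) w = inner ℝ f (ι w)) {μ : ℝ} (hμ : μ + ν ≠ 0)
    (hres : μ ∈ opResolventSet (formOperator ι a)) : (μ + ν)⁻¹ ∉ spectrum ℝ (ι ∘L L) := by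
  obtain ⟨R, hR1, hR2⟩ := hres
  set s := μ + ν with hs
  rw [spectrum.notMem_iff]
  -- the inverse of `s⁻¹ - T` is `s (1 + s R)`, where `R = (A - μ)⁻¹`
  refine isUnit_iff_exists.mpr ⟨s • ((1 : H →L[ℝ] H) + s • R), ?_, ?_⟩
  · ext y
    obtain ⟨x, hx, hx'⟩ := hR2 y
    have h1 : ι (L (y + s • R y)) = R y := by
      rw [show y + s • R y = formOperator ι a x + ν • (x : H) by
          rw [← hx, ← hx', hs]; module,
        h.resolvent_apply_eq hι hd hL x, hx]
    simp only [Algebra.algebraMap_eq_smul_one, mul_apply_eq_comp, sub_apply, smul_apply,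
      one_apply_eq_self, add_apply, ContinuousLinearMap.comp_apply]
    rw [map_smul, map_smul, h1, smul_smul, inv_mul_cancel₀ hμ]
    module
  · ext f
    obtain ⟨x, hx, hx'⟩ := exists_domain_eq_resolvent hι hd hL f
    have h1 := hR1 x
    rw [hx', hx] at h1
    have h2 : R (f - s • ι (L f)) = ι (L f) := by
      rw [show f - s • ι (L f) = f - ν • ι (L f) - μ • ι (L f) by rw [hs]; module, h1]
    have h3 : s⁻¹ • f - ι (L f) = s⁻¹ • (f - s • ι (L f)) := by
      rw [smul_sub, smul_smul, inv_mul_cancel₀ hμ, one_smul]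
    simp only [Algebra.algebraMap_eq_smul_one, mul_apply_eq_comp, sub_apply, smul_apply,
      one_apply_eq_self, add_apply, ContinuousLinearMap.comp_apply]
    rw [h3, map_smul, h2, smul_add, smul_smul, smul_smul, smul_smul, mul_inv_cancel₀ hμ, one_smul,
      mul_assoc, mul_inv_cancel₀ hμ, mul_one]
    module

/-- Finite multiplicity passes from `A` to `T = (A + ν)⁻¹`: the eigenvectors of `T` for `(μ + ν)⁻¹`
are eigenvectors of `A` for `μ`. -/
theorem finiteDimensional_eigenspace_resolvent (hι : Function.Injective ι)
    (hd : DenseRange ι) {L : H →L[ℝ] V}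
    (hL : ∀ f w, shiftedForm ι a ν (L f) w = inner ℝ f (ι w)) {μ : ℝ} (hμ : μ + ν ≠ 0)
    (hfin : FiniteDimensional ℝ (kerSub (formOperator ι a) μ)) :
    FiniteDimensional ℝ (Module.End.eigenspace ((ι ∘L L : H →L[ℝ] H) : H →ₗ[ℝ] H) (μ + ν)⁻¹) := by
  set W : Submodule ℝ H := (kerSub (formOperator ι a) μ).map (formOperator ι a).domain.subtype
  have hW : FiniteDimensional ℝ W := inferInstance
  refine Submodule.finiteDimensional_of_le (S₂ := W) fun f hf => ?_
  have hf' : ι (L f) = (μ + ν)⁻¹ • f := by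
    simpa using Module.End.mem_eigenspace_iff.mp hf
  obtain ⟨x, hx, hx'⟩ := exists_domain_eq_resolvent hι hd hL f
  rw [hf'] at hx hx'
  have hmem : x ∈ kerSub (formOperator ι a) μ := by
    rw [kerSub, LinearMap.mem_ker, LinearMap.sub_apply, LinearMap.smul_apply,
      Submodule.subtype_apply, hx, sub_eq_zero]
    refine hx'.trans ?_
    rw [sub_eq_iff_eq_add, ← add_smul, smul_smul, mul_inv_cancel₀ hμ, one_smul]
  have : f = (μ + ν) • (x : H) := by rw [hx, smul_smul, mul_inv_cancel₀ hμ, one_smul]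
  rw [this]
  exact W.smul_mem _ (Submodule.mem_map_of_mem hmem)

/-- Quantitative form of the spectral gap. For a level `m` between `l` and the essential spectrum and
`k = (m + ν)⁻¹ < (l + ν)⁻¹`, the vectors `f i` form an orthonormal basis of the span of the
eigenvectors of `A` with eigenvalue at most `m`. For `v` orthogonal to them in `H`, the bound says
that `(m + ν) ‖v‖ ^ 2 ≤ b(v, v)`; the sum measures the component along them. -/
theorem exists_quartic_bound [CompleteSpace V] [CompleteSpace H]
    (h : IsGardingForm ι a γ ν) (hι : Function.Injective ι) (hd : DenseRange ι) {l : ℝ}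
    (hl0 : 0 < l + ν) (hl : (l : EReal) < minSpec (opEssSpec (formOperator ι a))) :
    ∃ k C : ℝ, 0 < k ∧ k * (l + ν) < 1 ∧ ∃ (n : ℕ) (f : Fin n → H), ∀ v : V,
      ‖ι v‖ ^ 4 ≤
        (k * ‖ι v‖ ^ 2 + C * ∑ i, inner ℝ (f i) (ι v) ^ 2) * shiftedForm ι a ν v v := by
  obtain ⟨L, hL⟩ := h.exists_solutionOperator
  obtain ⟨m, hlm, hm⟩ := EReal.lt_iff_exists_real_btwn.mp hl
  rw [EReal.coe_lt_coe_iff] at hlm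
  have hm0 : 0 < m + ν := by linarith
  set T : H →L[ℝ] H := ι ∘L L with hT
  have hTs := h.resolvent_symm hL
  -- a spectral value `t > 0` of `T` comes from the spectral value `t⁻¹ - ν` of `A`
  have hspec : ∀ t ∈ spectrum ℝ T, 0 < t → t⁻¹ - ν ∈ opSpec (formOperator ι a) := by
    intro t ht ht0 hres
    have h1 := h.inv_notMem_spectrum hι hd hL (by simpa using ht0.ne') hres
    rw [sub_add_cancel, inv_inv] at h1
    exact h1 ht
  obtain ⟨E, hEfin, hEinv, hE⟩ := exists_finiteDimensional_le T hTs (k := (m + ν)⁻¹) (by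
    intro t ht hkt
    have ht0 : 0 < t := lt_of_lt_of_le (inv_pos.mpr hm0) hkt
    have hA := hspec t ht ht0
    have hle : t⁻¹ - ν ≤ m := by
      have := inv_anti₀ (inv_pos.mpr hm0) hkt
      rw [inv_inv] at this
      linarith
    have hdisc : t⁻¹ - ν ∈ opDiscreteSpec (formOperator ι a) := by
      by_contra hnd
      have h1 : minSpec (opEssSpec (formOperator ι a)) ≤ ((t⁻¹ - ν : ℝ) : EReal) :=
        sInf_le ⟨_, ⟨hA, hnd⟩, rfl⟩
      have h2 := hm.trans_le h1
      rw [EReal.coe_lt_coe_iff] at h2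
      linarith
    refine ⟨fun hacc => hdisc.2.1 ?_, ?_⟩
    · have hcont : ContinuousAt (fun s : ℝ => s⁻¹ - ν) t := by
        have := continuousAt_inv₀ ht0.ne'
        fun_prop
      rw [accPt_iff_frequently] at hacc ⊢
      have hev : ∀ᶠ s in 𝓝 t, 0 < s := lt_mem_nhds ht0
      refine hcont.tendsto.frequently ((hacc.and_eventually hev).mono ?_)
      rintro s ⟨⟨hst, hs⟩, hs0⟩
      refine ⟨fun heq => hst ?_, hspec s hs hs0⟩
      exact inv_injective (sub_left_injective heq)
    · have h1 := finiteDimensional_eigenspace_resolvent (ν := ν) hι hd hL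
        (by simpa using ht0.ne') hdisc.2.2.2
      rwa [sub_add_cancel, inv_inv] at h1)
  set e := stdOrthonormalBasis ℝ E with he
  refine ⟨(m + ν)⁻¹, ‖T‖, inv_pos.mpr hm0, ?_, _, fun i => (e i : H), fun v => ?_⟩
  · rw [inv_mul_lt_one₀ hm0]; linarith
  set x := ι v with hx
  set p : H := E.starProjection x with hp
  have hpE : p ∈ E := Submodule.starProjection_apply_mem _ _
  have hqE : x - p ∈ Eᗮ := Submodule.sub_starProjection_mem_orthogonal _
  have hps : ‖p‖ ^ 2 = ∑ i, inner ℝ (e i : H) x ^ 2 := by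
    have h1 := e.sum_sq_norm_inner_right (E.orthogonalProjectionOnto x)
    have h2 : ‖p‖ = ‖E.orthogonalProjectionOnto x‖ := rfl
    rw [h2, ← h1]
    refine Finset.sum_congr rfl fun i _ => ?_
    rw [Real.norm_eq_abs, sq_abs, Submodule.inner_orthogonalProjectionOnto_eq_of_mem_left]
  have hpyth : ‖x‖ ^ 2 = ‖p‖ ^ 2 + ‖x - p‖ ^ 2 := by
    have h1 : inner ℝ p (x - p) = 0 := hqE p hpE
    have h2 := norm_add_sq_real p (x - p)
    rw [add_sub_cancel, h1] at h2
    linarith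
  have hTx : inner ℝ (T x) x ≤ (m + ν)⁻¹ * ‖x‖ ^ 2 + ‖T‖ * ‖p‖ ^ 2 := by
    have h1 : inner ℝ (T x) x = inner ℝ (T p) p + inner ℝ (T (x - p)) (x - p) := by
      have h2 : inner ℝ (T p) (x - p) = 0 := hqE _ (hEinv p hpE)
      have h3 : inner ℝ (T (x - p)) p = 0 := by
        rw [hTs, real_inner_comm]; exact h2
      nth_rewrite 1 2 [← add_sub_cancel p x]
      rw [map_add, inner_add_left, inner_add_right, inner_add_right, h2, h3]
      ring
    have h4 : inner ℝ (T p) p ≤ ‖T‖ * ‖p‖ ^ 2 := by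
      nlinarith [real_inner_le_norm (T p) p, T.le_opNorm p, norm_nonneg p]
    have h5 := hE _ hqE
    have h6 : (m + ν)⁻¹ * ‖x - p‖ ^ 2 ≤ (m + ν)⁻¹ * ‖x‖ ^ 2 := by
      have := inv_pos.mpr hm0
      exact mul_le_mul_of_nonneg_left (by linarith [sq_nonneg ‖p‖]) this.le
    linarith
  -- Cauchy–Schwarz for `b` applied to `‖x‖ ^ 2 = b(T x, v)`
  have hcs := h.cauchy_schwarz (L x) v
  rw [hL, hL, ← hx, real_inner_self_eq_norm_sq, ← pow_mul, real_inner_comm] at hcs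
  refine hcs.trans ?_
  rw [← hps]
  exact mul_le_mul_of_nonneg_right hTx (h.shiftedForm_nonneg v)

end IsGardingForm

end Form

/-! ### Weak convergence -/

section Weak

variable {V : Type*} [NormedAddCommGroup V] [InnerProductSpace ℝ V]

theorem weaklyConverges_iff {x : ℕ → V} {w : V} :
    WeaklyConverges x w ↔ ∀ f : V →L[ℝ] ℝ, Tendsto (fun k => f (x k)) atTop (𝓝 (f w)) := by
  refine WeakBilin.tendsto_iff_forall_eval_tendsto (topDualPairing ℝ V).flip ?_
  intro v w hvw
  refine sub_eq_zero.mp (inner_self_eq_zero (𝕜 := ℝ).mp ?_)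
  have h1 : innerSL ℝ (v - w) v = innerSL ℝ (v - w) w :=
    LinearMap.congr_fun hvw (innerSL ℝ (v - w))
  rw [innerSL_apply_apply, innerSL_apply_apply] at h1
  rw [inner_sub_right, h1, sub_self]

/-- Bounded sequences of a separable Hilbert space have weakly convergent subsequences. -/
theorem exists_weaklyConverges_subseq [CompleteSpace V] [TopologicalSpace.SeparableSpace V]
    {x : ℕ → V} {C : ℝ} (hx : ∀ n, ‖x n‖ ≤ C) :
    ∃ (w : V) (φ : ℕ → ℕ), StrictMono φ ∧ WeaklyConverges (x ∘ φ) w := by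
  obtain ⟨f, -, φ, hφ, hf⟩ := WeakDual.isSeqCompact_closedBall ℝ V 0 C
    (x := fun n => StrongDual.toWeakDual (InnerProductSpace.toDual ℝ V (x n)))
    (fun n => by simpa using hx n)
  refine ⟨(InnerProductSpace.toDual ℝ V).symm (WeakDual.toStrongDual f), φ, hφ,
    weaklyConverges_iff.mpr fun g => ?_⟩
  obtain ⟨y, rfl⟩ := (InnerProductSpace.toDual ℝ V).surjective g
  have h1 := tendsto_iff_forall_eval_tendsto_topDualPairing.mp hf y
  simp only [InnerProductSpace.toDual_apply_apply]
  convert h1 using 1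
  · ext n
    rw [real_inner_comm]
    rfl
  · rw [real_inner_comm, InnerProductSpace.toDual_symm_apply]
    rfl

/-- A uniformly bounded sequence of functionals that tends to `0` on a set with dense span tends
to `0` pointwise. -/
theorem tendsto_zero_of_dense_span {r : ℕ → V →L[ℝ] ℝ} {S : Set V}
    (hS : Dense (Submodule.span ℝ S : Set V)) {K : ℝ} (hK : ∀ n, ‖r n‖ ≤ K)
    (h : ∀ v ∈ S, Tendsto (fun n => r n v) atTop (𝓝 0)) (v : V) :
    Tendsto (fun n => r n v) atTop (𝓝 0) := by
  have hspan : ∀ v ∈ Submodule.span ℝ S, Tendsto (fun n => r n v) atTop (𝓝 0) := by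
    intro v hv
    induction hv using Submodule.span_induction with
    | mem v hv => exact h v hv
    | zero => simp
    | add v w _ _ hv hw => simpa using hv.add hw
    | smul c v _ hv => simpa using hv.const_mul c
  have hK0 : 0 ≤ K := (norm_nonneg _).trans (hK 0)
  rw [Metric.tendsto_atTop]
  intro ε hε
  obtain ⟨w, hw, hvw⟩ := Metric.dense_iff.mp hS v (ε / (2 * (K + 1))) (by positivity)
  obtain ⟨N, hN⟩ := Metric.tendsto_atTop.mp (hspan w hvw) (ε / 2) (by positivity)
  refine ⟨N, fun n hn => ?_⟩
  have h1 := hN n hn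
  rw [Real.dist_eq, sub_zero] at h1 ⊢
  have h2 : |r n (v - w)| ≤ ε / 2 := by
    calc |r n (v - w)| ≤ ‖r n‖ * ‖v - w‖ := (r n).le_opNorm _
      _ ≤ (K + 1) * (ε / (2 * (K + 1))) := by
        gcongr
        · linarith [hK n]
        · rw [← dist_eq_norm, dist_comm]; exact (Metric.mem_ball.mp hw).le
      _ = ε / 2 := by field_simp
  rw [map_sub] at h2
  have h3 := abs_sub_abs_le_abs_sub (r n v) (r n w)
  linarith

end Weak

/-! ### Strong convergence of approximate eigenvectors below the essential spectrum -/

section Compactness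

variable {V H : Type*} [NormedAddCommGroup V] [InnerProductSpace ℝ V]
  [NormedAddCommGroup H] [InnerProductSpace ℝ H]

/-- The residual `z ↦ a(u, z) - a(u, u) ⟨u, z⟩` of an approximate eigenvector `u`. -/
noncomputable def residual (ι : V →L[ℝ] H) (a : V →L[ℝ] V →L[ℝ] ℝ) (u : V) : V →L[ℝ] ℝ :=
  a u - a u u • (innerSL ℝ (ι u)).comp ι

@[simp]
theorem residual_apply (ι : V →L[ℝ] H) (a : V →L[ℝ] V →L[ℝ] ℝ) (u z : V) :
    residual ι a u z = a u z - a u u * inner ℝ (ι u) (ι z) := by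
  simp [residual]

/-- A bounded `X ≥ 0` with `X ^ 2 ≤ (k X + o(1)) (c X + o(1))` and `k c < 1` tends to `0`. -/
theorem tendsto_zero_of_quartic {X d s : ℕ → ℝ} {k c C M : ℝ} (hk : 0 < k) (hc : 0 < c)
    (hkc : k * c < 1) (hX0 : ∀ n, 0 ≤ X n) (hXM : ∀ n, X n ≤ M) (hs0 : ∀ n, 0 ≤ s n)
    (hd : Tendsto d atTop (𝓝 0)) (hs : Tendsto s atTop (𝓝 0))
    (h : ∀ n, X n ^ 2 ≤ (k * X n + C * s n) * (c * X n + d n)) : Tendsto X atTop (𝓝 0) := by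
  have hb : Tendsto (fun n => (1 - k * c)⁻¹ *
      (k * M * |d n| + |C| * s n * (c * M) + |C| * s n * |d n|)) atTop (𝓝 0) := by
    have hd' : Tendsto (fun n => |d n|) atTop (𝓝 0) := by simpa using hd.abs
    have := ((((hd'.const_mul (k * M)).add ((hs.const_mul |C|).mul_const (c * M))).add
      ((hs.const_mul |C|).mul hd')).const_mul (1 - k * c)⁻¹)
    simpa using this
  have hsq : Tendsto (fun n => X n ^ 2) atTop (𝓝 0) := by
    refine squeeze_zero (fun n => sq_nonneg _) (fun n => ?_) hb
    rw [le_inv_mul_iff₀ (by linarith)]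
    have h1 : k * (X n * d n) ≤ k * M * |d n| := by
      calc k * (X n * d n) ≤ k * (X n * |d n|) := by
            gcongr
            · exact hX0 n
            · exact le_abs_self _
        _ ≤ k * (M * |d n|) := by gcongr; exact hXM n
        _ = _ := by ring
    have h2 : C * s n * (c * X n) ≤ |C| * s n * (c * M) := by
      have := hs0 n
      have := hX0 n
      have := hXM n
      gcongr
      exact le_abs_self C
    have h3 : C * s n * d n ≤ |C| * s n * |d n| := by
      rw [← abs_of_nonneg (hs0 n), ← abs_mul, ← abs_mul, abs_of_nonneg (hs0 n)]
      exact le_abs_self _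
    nlinarith [h n]
  have := hsq.sqrt
  simp only [Real.sqrt_zero] at this
  exact this.congr fun n => Real.sqrt_sq (hX0 n)

/-- A weakly convergent sequence of `H`-normalized approximate eigenvectors, whose Rayleigh quotients
converge below the essential spectrum, converges strongly to a normalized eigenvector. The error
`e = u n - w` satisfies `b(e, e) = (l + ν) ‖e‖ ^ 2 + o(1)`, which together with the bound
`exists_quartic_bound` forces `‖e‖ → 0`. -/
theorem IsGardingForm.tendsto_of_weaklyConverges [CompleteSpace V] [CompleteSpace H]
    {ι : V →L[ℝ] H} {a : V →L[ℝ] V →L[ℝ] ℝ} {γ ν : ℝ}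
    (h : IsGardingForm ι a γ ν) (hι : Function.Injective ι) (hd : DenseRange ι) {l : ℝ}
    (hl0 : 0 < l + ν) (hl : (l : EReal) < minSpec (opEssSpec (formOperator ι a)))
    {u : ℕ → V} (hu : ∀ n, ‖ι (u n)‖ = 1) (hlim : Tendsto (fun n => a (u n) (u n)) atTop (𝓝 l))
    (hres : ∀ v, Tendsto (fun n => residual ι a (u n) v) atTop (𝓝 0))
    {w : V} (hw : WeaklyConverges u w) :
    Tendsto u atTop (𝓝 w) ∧ w ∈ normalizedEigenvectors ι a l := by
  rw [weaklyConverges_iff] at hw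
  have hH : ∀ g : H, Tendsto (fun n => inner ℝ g (ι (u n))) atTop (𝓝 (inner ℝ g (ι w))) :=
    fun g => hw ((innerSL ℝ g).comp ι)
  have heig : w ∈ formEigenspace ι a l := by
    intro v
    have h1 := (hw (a v)).sub (hlim.mul (hH (ι v)))
    have h2 := tendsto_nhds_unique (hres v) (h1.congr fun n => by
      rw [residual_apply, h.symm v, real_inner_comm])
    rw [h.symm w v, real_inner_comm]
    linarith
  obtain ⟨k, C, hk, hkl, n, f, hquart⟩ := h.exists_quartic_bound hι hd hl0 hl
  have hb : ∀ j, shiftedForm ι a ν (u j - w) (u j - w) =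
      (l + ν) * ‖ι (u j - w)‖ ^ 2 + (a (u j) (u j) - l) := by
    intro j
    have h1 : a w (u j) = l * inner ℝ (ι w) (ι (u j)) := heig (u j)
    have h2 : a w w = l * inner ℝ (ι w) (ι w) := heig w
    have h3 : a (u j) w = l * inner ℝ (ι w) (ι (u j)) := by rw [h.symm, h1]
    have h4 : inner ℝ (ι (u j)) (ι (u j)) = (1 : ℝ) := by
      rw [real_inner_self_eq_norm_sq, hu, one_pow]
    rw [shiftedForm_apply, ← real_inner_self_eq_norm_sq]
    simp only [map_sub, sub_apply, inner_sub_left, inner_sub_right]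
    rw [h1, h2, h3, h4, real_inner_comm (ι w) (ι (u j))]
    ring
  have hdl : Tendsto (fun j => a (u j) (u j) - l) atTop (𝓝 0) := by
    simpa using hlim.sub_const l
  have hX : Tendsto (fun j => ‖ι (u j - w)‖ ^ 2) atTop (𝓝 0) := by
    refine tendsto_zero_of_quartic (M := (1 + ‖ι w‖) ^ 2) hk hl0 hkl (fun j => sq_nonneg _)
      (fun j => ?_) (fun j => ?_) hdl (s := fun j => ∑ i, inner ℝ (f i) (ι (u j - w)) ^ 2) ?_
      (fun j => ?_) (C := C)
    · gcongr
      rw [map_sub]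
      exact (norm_sub_le _ _).trans_eq (by rw [hu])
    · exact Finset.sum_nonneg fun i _ => sq_nonneg _
    · have h1 : ∀ i, Tendsto (fun j => inner ℝ (f i) (ι (u j - w)) ^ 2) atTop (𝓝 0) := by
        intro i
        have h2 := ((hH (f i)).sub_const (inner ℝ (f i) (ι w))).pow 2
        rw [sub_self, zero_pow two_ne_zero] at h2
        exact h2.congr fun j => by rw [map_sub, inner_sub_right]
      simpa using tendsto_finsetSum Finset.univ fun i _ => h1 i
    · rw [← pow_mul, ← hb]
      exact hquart _
  have hconv : Tendsto u atTop (𝓝 w) := by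
    rw [tendsto_iff_norm_sub_tendsto_zero]
    have h1 : Tendsto (fun j => γ⁻¹ * ((l + ν) * ‖ι (u j - w)‖ ^ 2 + (a (u j) (u j) - l)))
        atTop (𝓝 0) := by
      simpa using (((hX.const_mul (l + ν)).add hdl).const_mul γ⁻¹)
    have h2 : Tendsto (fun j => ‖u j - w‖ ^ 2) atTop (𝓝 0) := by
      refine squeeze_zero (fun j => sq_nonneg _) (fun j => ?_) h1
      rw [le_inv_mul_iff₀ h.gamma_pos, ← hb]
      exact h.coercive _
    have h3 := h2.sqrt
    simp only [Real.sqrt_zero] at h3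
    exact h3.congr fun n => Real.sqrt_sq (norm_nonneg _)
  refine ⟨hconv, heig, ?_⟩
  have h1 : Tendsto (fun j => ‖ι (u j)‖) atTop (𝓝 ‖ι w‖) :=
    ((ι.continuous.tendsto w).comp hconv).norm
  simp only [hu] at h1
  exact (tendsto_nhds_unique h1 tendsto_const_nhds)

end Compactness

/-! ### The residual minimization step -/

section Step

variable {V H : Type*} [NormedAddCommGroup V] [InnerProductSpace ℝ V]
  [NormedAddCommGroup H] [InnerProductSpace ℝ H]
  {ι : V →L[ℝ] H} {a : V →L[ℝ] V →L[ℝ] ℝ} {γ ν : ℝ} {S : Set V}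

namespace IsGardingForm

/-- Up to the constant `b(u, u) / 2`, the objective of the residual minimization problem is
`b(z, z) / 2` plus the residual at `z`. -/
theorem objective_eq (h : IsGardingForm ι a γ ν) (u z : V) :
    (1 / 2) * aNorm ι a ν (u + z) ^ 2 - (a u u + ν) * inner ℝ (ι u) (ι z) =
      shiftedForm ι a ν u u / 2 + (shiftedForm ι a ν z z / 2 + residual ι a u z) := by
  rw [h.aNorm_sq]
  have h1 : inner ℝ (ι z) (ι u) = (inner ℝ (ι u) (ι z) : ℝ) := real_inner_comm _ _
  simp only [residual_apply, shiftedForm_apply, map_add, add_apply, h1, h.symm z u]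
  ring

theorem isResidualMin_iff (h : IsGardingForm ι a γ ν) {u z : V} :
    IsResidualMin ι a ν S u z ↔ z ∈ S ∧ ∀ y ∈ S,
      shiftedForm ι a ν z z / 2 + residual ι a u z ≤
        shiftedForm ι a ν y y / 2 + residual ι a u y := by
  rw [IsResidualMin, isMinOn_iff]
  simp only [h.objective_eq, add_le_add_iff_left]

/-- Optimality along the lines of the cone `S`. -/
theorem isResidualMin_line (h : IsGardingForm ι a γ ν) (hS : ∀ z ∈ S, ∀ t : ℝ, t • z ∈ S)
    {u z : V} (hz : IsResidualMin ι a ν S u z) {y : V} (hy : y ∈ S) (t : ℝ) :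
    shiftedForm ι a ν z z / 2 + residual ι a u z ≤
      t ^ 2 * shiftedForm ι a ν y y / 2 + t * residual ι a u y := by
  have h1 := (h.isResidualMin_iff.mp hz).2 (t • y) (hS y hy t)
  rw [map_smul, map_smul, smul_apply, map_smul, smul_eq_mul, smul_eq_mul, smul_eq_mul] at h1
  linarith

theorem residual_self (h : IsGardingForm ι a γ ν) (hS : ∀ z ∈ S, ∀ t : ℝ, t • z ∈ S)
    {u z : V} (hz : IsResidualMin ι a ν S u z) :
    residual ι a u z = -shiftedForm ι a ν z z := by
  by_cases h0 : shiftedForm ι a ν z z = 0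
  · have : z = 0 := h.eq_zero_of_shiftedForm h0.le
    simp [this]
  have hpos : 0 < shiftedForm ι a ν z z := lt_of_le_of_ne (h.shiftedForm_nonneg z) (Ne.symm h0)
  set r := residual ι a u z with hr
  set b := shiftedForm ι a ν z z with hb
  have h1 := h.isResidualMin_line hS hz hz.1 (-r / b)
  rw [← hr, ← hb] at h1
  have h2 : (-r / b) ^ 2 * b / 2 + -r / b * r = -(r ^ 2 / b) / 2 := by
    field_simp
    ring
  rw [h2] at h1
  have h3 : (b + r) ^ 2 ≤ 0 := by
    have h4 : r ^ 2 / b * b = r ^ 2 := div_mul_cancel₀ _ hpos.ne'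
    nlinarith
  have h5 : b + r = 0 := pow_eq_zero_iff two_ne_zero |>.mp (le_antisymm h3 (sq_nonneg _))
  linarith

/-- The selected element realizes the dual norm of the residual over the dictionary. -/
theorem residual_sq_le (h : IsGardingForm ι a γ ν) (hS : ∀ z ∈ S, ∀ t : ℝ, t • z ∈ S)
    {u z : V} (hz : IsResidualMin ι a ν S u z) {y : V} (hy : y ∈ S) :
    residual ι a u y ^ 2 ≤ shiftedForm ι a ν z z * shiftedForm ι a ν y y := by
  by_cases h0 : shiftedForm ι a ν y y = 0
  · have : y = 0 := h.eq_zero_of_shiftedForm h0.le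
    simp [this]
  have hpos : 0 < shiftedForm ι a ν y y := lt_of_le_of_ne (h.shiftedForm_nonneg y) (Ne.symm h0)
  have h1 := h.isResidualMin_line hS hz hy (-residual ι a u y / shiftedForm ι a ν y y)
  rw [h.residual_self hS hz] at h1
  set r := residual ι a u y with hr
  set b := shiftedForm ι a ν y y with hb
  have h2 : (-r / b) ^ 2 * b / 2 + -r / b * r = -(r ^ 2 / b) / 2 := by
    field_simp
    ring
  rw [h2] at h1
  have h4 : r ^ 2 / b * b = r ^ 2 := div_mul_cancel₀ _ hpos.ne'
  nlinarith

theorem add_ne_zero_of_isResidualMin (h : IsGardingForm ι a γ ν)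
    (hS : ∀ z ∈ S, ∀ t : ℝ, t • z ∈ S) {u z : V} (hu : ‖ι u‖ = 1)
    (hz : IsResidualMin ι a ν S u z) : u + z ≠ 0 := by
  intro h0
  have h1 : z = -u := (neg_eq_of_add_eq_zero_right h0).symm
  have h2 := h.residual_self hS hz
  have h3 : residual ι a u z = 0 := by
    rw [h1, map_neg, residual_apply, real_inner_self_eq_norm_sq, hu]
    ring
  have h4 : z = 0 := h.eq_zero_of_shiftedForm (by linarith)
  have h5 : u = 0 := by simpa [h4] using h0
  simp [h5] at hu

/-- The numerator of the Rayleigh quotient of `u + z` relative to that of `u`. -/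
theorem form_add_eq (h : IsGardingForm ι a γ ν)
    (hS : ∀ z ∈ S, ∀ t : ℝ, t • z ∈ S) {u z : V} (hu : ‖ι u‖ = 1)
    (hz : IsResidualMin ι a ν S u z) :
    a (u + z) (u + z) = a u u * ‖ι (u + z)‖ ^ 2 - shiftedForm ι a ν z z -
      shiftedForm ι a ν u u * ‖ι z‖ ^ 2 := by
  have h1 := h.residual_self hS hz
  have h2 : inner ℝ (ι u) (ι u) = (1 : ℝ) := by rw [real_inner_self_eq_norm_sq, hu, one_pow]
  simp only [residual_apply, shiftedForm_apply] at h1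
  rw [← real_inner_self_eq_norm_sq (ι z), ← real_inner_self_eq_norm_sq (ι (u + z))]
  simp only [shiftedForm_apply, map_add, add_apply, inner_add_left, inner_add_right, h.symm z u,
    h2]
  rw [real_inner_comm (ι u) (ι z)]
  linarith

/-- The residual minimization problem has a solution: the objective is coercive and weakly lower
semicontinuous, and the dictionary is weakly closed. -/
theorem exists_isResidualMin [CompleteSpace V] [TopologicalSpace.SeparableSpace V]
    (h : IsGardingForm ι a γ ν) (hS : IsDictionary S) (u : V) :
    ∃ z, IsResidualMin ι a ν S u z := by
  set r := residual ι a u with hr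
  set J : V → ℝ := fun z => shiftedForm ι a ν z z / 2 + r z with hJ
  have hγ := h.gamma_pos
  have hJlow : ∀ z, γ / 2 * ‖z‖ ^ 2 - ‖r‖ * ‖z‖ ≤ J z := by
    intro z
    have h1 := h.coercive z
    have h2 := (abs_le.mp (r.le_opNorm z)).1
    simp only [hJ]
    linarith
  have hbdd : BddBelow (J '' S) := by
    refine ⟨-(‖r‖ ^ 2 / (2 * γ)), ?_⟩
    rintro _ ⟨z, -, rfl⟩
    refine le_trans ?_ (hJlow z)
    have h1 : γ / 2 * ‖z‖ ^ 2 - ‖r‖ * ‖z‖ + ‖r‖ ^ 2 / (2 * γ) = (γ * ‖z‖ - ‖r‖) ^ 2 / (2 * γ) := by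
      field_simp
      ring
    have h2 : 0 ≤ (γ * ‖z‖ - ‖r‖) ^ 2 / (2 * γ) := by positivity
    linarith
  have hne : (J '' S).Nonempty := ⟨_, 0, hS.zero_mem, rfl⟩
  obtain ⟨x, -, hx, hxS⟩ := exists_seq_tendsto_sInf hne hbdd
  choose z hzS hzJ using hxS
  obtain ⟨M, hM⟩ := hx.bddAbove_range
  have hzb : ∀ n, ‖z n‖ ≤ 1 + 2 * (|M| + ‖r‖) / γ := by
    intro n
    by_contra! hlt
    have h1 : J (z n) ≤ |M| := by
      rw [hzJ]; exact (hM ⟨n, rfl⟩).trans (le_abs_self M)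
    have h2 := hJlow (z n)
    have h3 : 0 ≤ 2 * (|M| + ‖r‖) / γ := by positivity
    have h4 : 2 * (|M| + ‖r‖) < γ * ‖z n‖ := by
      have : 2 * (|M| + ‖r‖) / γ < ‖z n‖ := by linarith
      rwa [div_lt_iff₀' hγ] at this
    have h5 : 1 < ‖z n‖ := by linarith
    nlinarith [abs_nonneg M, norm_nonneg r]
  obtain ⟨w, φ, hφ, hw⟩ := exists_weaklyConverges_subseq hzb
  have hwS : w ∈ S := by
    have h1 := hS.weaklyClosed.mem_of_tendsto hw
      (Eventually.of_forall fun k => ⟨z (φ k), hzS _, rfl⟩)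
    obtain ⟨y, hy, hyw⟩ := h1
    rwa [← (toWeakSpace ℝ V).injective hyw]
  rw [weaklyConverges_iff] at hw
  refine ⟨w, h.isResidualMin_iff.mpr ⟨hwS, fun y hy => ?_⟩⟩
  have hlim : Tendsto (fun k => J (z (φ k))) atTop (𝓝 (sInf (J '' S))) := by
    simpa only [hzJ, Function.comp_def] using hx.comp hφ.tendsto_atTop
  -- weak lower semicontinuity from `b(z, z) ≥ 2 b(w, z) - b(w, w)`
  have hlow : Tendsto (fun k => (2 * shiftedForm ι a ν w (z (φ k)) - shiftedForm ι a ν w w) / 2 +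
      r (z (φ k))) atTop (𝓝 (J w)) := by
    have h1 := ((((hw (shiftedForm ι a ν w)).const_mul 2).sub_const
      (shiftedForm ι a ν w w)).div_const 2).add (hw r)
    have h2 : J w = (2 * shiftedForm ι a ν w w - shiftedForm ι a ν w w) / 2 + r w := by
      simp only [hJ]
      ring
    rw [h2]
    exact h1
  have hle : J w ≤ sInf (J '' S) := by
    refine le_of_tendsto_of_tendsto' hlow hlim fun k => ?_
    have h1 := h.shiftedForm_nonneg (z (φ k) - w)
    simp only [map_sub, sub_apply] at h1
    rw [h.shiftedForm_symm (z (φ k)) w] at h1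
    simp only [hJ]
    linarith
  exact hle.trans (csInf_le hbdd ⟨y, hy, rfl⟩)

end IsGardingForm

/-! ### Convergence of residual descent sequences -/

/-- The properties common to the iterates of both algorithms: normalized iterates whose energy does
not exceed the Rayleigh quotient of `u n + z (n + 1)`, where `z (n + 1)` is a solution of the
residual minimization problem. -/
structure IsResidualDescent (ι : V →L[ℝ] H) (a : V →L[ℝ] V →L[ℝ] ℝ) (ν : ℝ) (S : Set V)
    (z u : ℕ → V) : Prop where
  norm_eq : ∀ n, ‖ι (u n)‖ = 1
  isMin : ∀ n, IsResidualMin ι a ν S (u n) (z (n + 1))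
  descent : ∀ n, a (u (n + 1)) (u (n + 1)) * ‖ι (u n + z (n + 1))‖ ^ 2 ≤
    a (u n + z (n + 1)) (u n + z (n + 1))

namespace IsResidualDescent

variable {z u : ℕ → V}

theorem shiftedForm_self (hu : IsResidualDescent ι a ν S z u) (n : ℕ) :
    shiftedForm ι a ν (u n) (u n) = a (u n) (u n) + ν := by
  rw [shiftedForm_apply, real_inner_self_eq_norm_sq, hu.norm_eq]
  ring

theorem energy_step (hu : IsResidualDescent ι a ν S z u) (h : IsGardingForm ι a γ ν)
    (hS : IsDictionary S) (n : ℕ) :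
    shiftedForm ι a ν (z (n + 1)) (z (n + 1)) ≤
      (a (u n) (u n) - a (u (n + 1)) (u (n + 1))) * ‖ι (u n + z (n + 1))‖ ^ 2 := by
  have h1 := hu.descent n
  rw [h.form_add_eq hS.smul_mem (hu.norm_eq n) (hu.isMin n)] at h1
  have h2 := mul_nonneg (h.shiftedForm_nonneg (u n)) (sq_nonneg ‖ι (z (n + 1))‖)
  linarith

theorem antitone (hu : IsResidualDescent ι a ν S z u) (h : IsGardingForm ι a γ ν)
    (hι : Function.Injective ι) (hS : IsDictionary S) : Antitone fun n => a (u n) (u n) := by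
  refine antitone_nat_of_succ_le fun n => ?_
  have h1 := hu.energy_step h hS n
  have h2 := h.add_ne_zero_of_isResidualMin hS.smul_mem (hu.norm_eq n) (hu.isMin n)
  have h3 : 0 < ‖ι (u n + z (n + 1))‖ ^ 2 := by
    have : ι (u n + z (n + 1)) ≠ 0 := fun h0 => h2 (hι (by rw [h0, map_zero]))
    positivity
  by_contra! hlt
  nlinarith [h.shiftedForm_nonneg (z (n + 1))]

theorem exists_bound (hu : IsResidualDescent ι a ν S z u) (h : IsGardingForm ι a γ ν)
    (hι : Function.Injective ι) (hS : IsDictionary S) : ∃ C : ℝ, ∀ n, ‖u n‖ ≤ C := by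
  refine ⟨√(γ⁻¹ * (a (u 0) (u 0) + ν)), fun n => Real.le_sqrt_of_sq_le ?_⟩
  rw [le_inv_mul_iff₀ h.gamma_pos]
  refine (h.coercive (u n)).trans ?_
  rw [hu.shiftedForm_self]
  linarith [hu.antitone h hι hS (Nat.zero_le n)]

theorem exists_residual_bound (hu : IsResidualDescent ι a ν S z u) (h : IsGardingForm ι a γ ν)
    (hι : Function.Injective ι) (hS : IsDictionary S) :
    ∃ K : ℝ, ∀ n, ‖residual ι a (u n)‖ ≤ K := by
  obtain ⟨C, hC⟩ := hu.exists_bound h hι hS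
  have hC0 : 0 ≤ C := (norm_nonneg _).trans (hC 0)
  refine ⟨‖a‖ * C + ‖a‖ * C * C * (1 * ‖ι‖), fun n => ?_⟩
  have h1 : ‖a (u n)‖ ≤ ‖a‖ * C := (a.le_opNorm _).trans (by gcongr; exact hC n)
  have h2 : ‖a (u n) (u n)‖ ≤ ‖a‖ * C * C :=
    ((a (u n)).le_opNorm _).trans (by gcongr; exact hC n)
  have h3 : ‖(innerSL ℝ (ι (u n))).comp ι‖ ≤ 1 * ‖ι‖ := by
    refine (ContinuousLinearMap.opNorm_comp_le _ _).trans ?_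
    rw [innerSL_apply_norm, hu.norm_eq]
  refine (norm_sub_le _ _).trans (add_le_add h1 ?_)
  rw [norm_smul]
  gcongr

/-- Since `1 = ‖ι (u n)‖ ≤ ‖ι‖ ‖u n‖_V`, coercivity keeps the energies away from `-ν`. -/
theorem le_energy_add (hu : IsResidualDescent ι a ν S z u) (h : IsGardingForm ι a γ ν) (n : ℕ) :
    γ / (‖ι‖ ^ 2 + 1) ≤ a (u n) (u n) + ν := by
  rw [← hu.shiftedForm_self]
  refine le_trans ?_ (h.coercive (u n))
  rw [div_le_iff₀ (by positivity), mul_assoc]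
  refine le_mul_of_one_le_right h.gamma_pos.le ?_
  have h1 := ι.le_opNorm (u n)
  rw [hu.norm_eq] at h1
  nlinarith [sq_nonneg ‖u n‖, mul_nonneg (norm_nonneg ι) (norm_nonneg (u n))]

theorem exists_tendsto (hu : IsResidualDescent ι a ν S z u) (h : IsGardingForm ι a γ ν)
    (hι : Function.Injective ι) (hS : IsDictionary S) :
    ∃ l : ℝ, Tendsto (fun n => a (u n) (u n)) atTop (𝓝 l) := by
  refine ⟨_, tendsto_atTop_ciInf (hu.antitone h hι hS) ⟨γ / (‖ι‖ ^ 2 + 1) - ν, ?_⟩⟩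
  rintro _ ⟨n, rfl⟩
  simp only
  linarith [hu.le_energy_add h n]

/-- The corrections tend to `0`, since the energy decreases by a multiple of `b(z, z)`. -/
theorem tendsto_shiftedForm (hu : IsResidualDescent ι a ν S z u) (h : IsGardingForm ι a γ ν)
    (hι : Function.Injective ι) (hS : IsDictionary S) :
    Tendsto (fun n => shiftedForm ι a ν (z (n + 1)) (z (n + 1))) atTop (𝓝 0) := by
  obtain ⟨K, hK⟩ := hu.exists_residual_bound h hι hS
  obtain ⟨l, hl⟩ := hu.exists_tendsto h hι hS
  have hz : ∀ n, ‖z (n + 1)‖ ≤ K / γ := by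
    intro n
    rw [le_div_iff₀ h.gamma_pos]
    have h1 := h.coercive (z (n + 1))
    have h2 := h.residual_self hS.smul_mem (hu.isMin n)
    have h3 := ((abs_le.mp ((residual ι a (u n)).le_opNorm (z (n + 1)))).1)
    have h4 : γ * ‖z (n + 1)‖ ^ 2 ≤ K * ‖z (n + 1)‖ := by
      nlinarith [norm_nonneg (z (n + 1)), hK n]
    rcases (norm_nonneg (z (n + 1))).eq_or_lt' with h0 | h0
    · rw [h0, zero_mul]; exact (norm_nonneg _).trans (hK n)
    · nlinarith
  have hy : ∀ n, ‖ι (u n + z (n + 1))‖ ^ 2 ≤ (1 + ‖ι‖ * (K / γ)) ^ 2 := by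
    intro n
    gcongr
    rw [map_add]
    refine (norm_add_le _ _).trans (add_le_add (hu.norm_eq n).le ?_)
    exact (ι.le_opNorm _).trans (by gcongr; exact hz n)
  have hdiff : Tendsto (fun n => (a (u n) (u n) - a (u (n + 1)) (u (n + 1))) *
      (1 + ‖ι‖ * (K / γ)) ^ 2) atTop (𝓝 0) := by
    have := (hl.sub (hl.comp (tendsto_add_atTop_nat 1))).mul_const ((1 + ‖ι‖ * (K / γ)) ^ 2)
    simpa using this
  refine squeeze_zero (fun n => h.shiftedForm_nonneg _) (fun n => ?_) hdiff
  refine (hu.energy_step h hS n).trans ?_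
  have : 0 ≤ a (u n) (u n) - a (u (n + 1)) (u (n + 1)) :=
    sub_nonneg.mpr (hu.antitone h hι hS (Nat.le_succ n))
  exact mul_le_mul_of_nonneg_left (hy n) this

theorem tendsto_correction (hu : IsResidualDescent ι a ν S z u) (h : IsGardingForm ι a γ ν)
    (hι : Function.Injective ι) (hS : IsDictionary S) :
    Tendsto (fun n => ‖z (n + 1)‖) atTop (𝓝 0) := by
  have h1 : Tendsto (fun n => ‖z (n + 1)‖ ^ 2) atTop (𝓝 0) := by
    have h2 := (hu.tendsto_shiftedForm h hι hS).const_mul γ⁻¹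
    rw [mul_zero] at h2
    refine squeeze_zero (fun n => sq_nonneg _) (fun n => ?_) h2
    rw [le_inv_mul_iff₀ h.gamma_pos]
    exact h.coercive _
  have h3 := h1.sqrt
  simp only [Real.sqrt_zero] at h3
  exact h3.congr fun n => Real.sqrt_sq (norm_nonneg _)

theorem tendsto_residual (hu : IsResidualDescent ι a ν S z u) (h : IsGardingForm ι a γ ν)
    (hι : Function.Injective ι) (hS : IsDictionary S) (v : V) :
    Tendsto (fun n => residual ι a (u n) v) atTop (𝓝 0) := by
  obtain ⟨K, hK⟩ := hu.exists_residual_bound h hι hS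
  refine tendsto_zero_of_dense_span hS.dense_span hK (fun y hy => ?_) v
  have h1 : Tendsto (fun n => residual ι a (u n) y ^ 2) atTop (𝓝 0) := by
    refine squeeze_zero (fun n => sq_nonneg _)
      (fun n => h.residual_sq_le hS.smul_mem (hu.isMin n) hy) ?_
    simpa using (hu.tendsto_shiftedForm h hι hS).mul_const (shiftedForm ι a ν y y)
  have h3 := h1.sqrt
  simp only [Real.sqrt_zero, Real.sqrt_sq_eq_abs] at h3
  exact tendsto_zero_iff_abs_tendsto_zero _ |>.mpr h3

end IsResidualDescent

/-- A sequence that approaches `{w, -w}`, and whose successive terms are not opposite, converges. -/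
theorem tendsto_of_tendsto_pair {u : ℕ → V} {w : V} (hw : ‖ι w‖ = 1)
    (hmin : Tendsto (fun n => min ‖u n - w‖ ‖u n + w‖) atTop (𝓝 0))
    (hor : ∀ᶠ n in atTop, 0 ≤ inner ℝ (ι (u n)) (ι (u (n + 1)))) :
    Tendsto u atTop (𝓝 w) ∨ Tendsto u atTop (𝓝 (-w)) := by
  set δ : ℝ := 1 / (4 * (‖ι‖ + 1)) with hδ
  have hδ0 : 0 < δ := by positivity
  have hsmall : ∀ x : V, ‖x‖ < δ → ‖ι x‖ ≤ 1 / 4 := by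
    intro x hx
    calc ‖ι x‖ ≤ ‖ι‖ * ‖x‖ := ι.le_opNorm x
      _ ≤ (‖ι‖ + 1) * δ := by gcongr; linarith
      _ = 1 / 4 := by rw [hδ]; field_simp
  obtain ⟨N, hN⟩ := eventually_atTop.mp ((hmin.eventually_lt_const hδ0).and hor)
  -- once the sequence is close to `w'`, it stays there
  have key : ∀ w' : V, ‖ι w'‖ = 1 →
      (∀ n, min ‖u n - w‖ ‖u n + w‖ = min ‖u n - w'‖ ‖u n + w'‖) →
      ‖u N - w'‖ < δ → Tendsto u atTop (𝓝 w') := by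
    intro w' hw' heq hstart
    have hclose : ∀ n ≥ N, ‖u n - w'‖ < δ := by
      intro n hn
      induction n, hn using Nat.le_induction with
      | base => exact hstart
      | succ n hn ih =>
        by_contra hcon
        have h1 := (hN (n + 1) (by omega)).1
        rw [heq, min_lt_iff] at h1
        have h2 := hsmall _ (h1.resolve_left hcon)
        have h3 := hsmall _ ih
        have h4 := (hN n hn).2
        set p := ι (u n - w') with hp
        set q := ι (u (n + 1) + w') with hq
        have h5 : ι (u n) = ι w' + p := by rw [hp, map_sub]; abel
        have h6 : ι (u (n + 1)) = q - ι w' := by rw [hq, map_add]; abel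
        rw [h5, h6, inner_add_left, inner_sub_right, inner_sub_right, real_inner_self_eq_norm_sq,
          hw'] at h4
        have h7 := real_inner_le_norm (ι w') q
        have h8 := real_inner_le_norm p q
        have h9 := (abs_le.mp (abs_real_inner_le_norm p (ι w'))).1
        rw [hw'] at h7 h9
        nlinarith [norm_nonneg p, norm_nonneg q]
    rw [tendsto_iff_norm_sub_tendsto_zero]
    refine hmin.congr' ?_
    filter_upwards [eventually_ge_atTop N] with n hn
    rw [heq, min_eq_left]
    have h1 := hclose n hn
    by_contra! hlt
    have h2 := hsmall _ h1
    have h3 := hsmall _ (hlt.trans h1)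
    have h4 : ι (u n + w') - ι (u n - w') = (2 : ℝ) • ι w' := by
      rw [map_add, map_sub]; module
    have h5 := norm_sub_le (ι (u n + w')) (ι (u n - w'))
    rw [h4, norm_smul, hw', Real.norm_ofNat] at h5
    linarith
  rcases min_lt_iff.mp (hN N le_rfl).1 with h1 | h1
  · exact Or.inl (key w hw (fun _ => rfl) h1)
  · refine Or.inr (key (-w) (by simpa using hw) (fun n => ?_) (by simpa using h1))
    rw [sub_neg_eq_add, ← sub_eq_add_neg, min_comm]

/-- When the eigenspace is a line, the normalized eigenvectors are `w` and `-w`. -/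
theorem eq_or_eq_neg_of_finrank_eq_one {l : ℝ}
    (hsimple : Module.finrank ℝ (formEigenspace ι a l) = 1) {w v : V}
    (hw : w ∈ normalizedEigenvectors ι a l) (hv : v ∈ normalizedEigenvectors ι a l) :
    v = w ∨ v = -w := by
  have hw0 : (⟨w, hw.1⟩ : formEigenspace ι a l) ≠ 0 := by
    intro h0
    have h1 : w = 0 := congrArg Subtype.val h0
    have := hw.2
    simp [h1] at this
  obtain ⟨c, hc⟩ := (finrank_eq_one_iff_of_nonzero' _ hw0).mp hsimple ⟨v, hv.1⟩
  have hc' : c • w = v := congrArg Subtype.val hc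
  have h1 := hv.2
  rw [← hc', map_smul, norm_smul, hw.2, mul_one, Real.norm_eq_abs] at h1
  rcases eq_or_eq_neg_of_abs_eq h1 with h2 | h2
  · left; rw [← hc', h2, one_smul]
  · right; rw [← hc', h2, neg_smul, one_smul]

/-- Every residual descent sequence started below the essential spectrum converges to an eigenpair.
All the limits are obtained along subsequences, from weak compactness and
`IsGardingForm.tendsto_of_weaklyConverges`; the condition on successive iterates is only used to
fix the sign of the limit of the whole sequence when the eigenvalue is simple. -/
theorem IsResidualDescent.convergesToEigenpair [CompleteSpace V] [CompleteSpace H]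
    [TopologicalSpace.SeparableSpace V] {z u : ℕ → V}
    (hu : IsResidualDescent ι a ν S z u) (h : IsGardingForm ι a γ ν)
    (hι : Function.Injective ι) (hd : DenseRange ι) (hS : IsDictionary S)
    (hhigh : ((a (u 0) (u 0) : ℝ) : EReal) < minSpec (opEssSpec (formOperator ι a)))
    (hor : ∀ᶠ n in atTop, 0 ≤ inner ℝ (ι (u n)) (ι (u (n + 1)))) :
    ∃ l : ℝ, ConvergesToEigenpair ι a ν u l := by
  obtain ⟨l, hl⟩ := hu.exists_tendsto h hι hS
  obtain ⟨C, hC⟩ := hu.exists_bound h hι hS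
  have hlu : l ≤ a (u 0) (u 0) := (hu.antitone h hι hS).le_of_tendsto hl 0
  have hless : (l : EReal) < minSpec (opEssSpec (formOperator ι a)) :=
    lt_of_le_of_lt (EReal.coe_le_coe_iff.mpr hlu) hhigh
  have hl0 : 0 < l + ν := by
    have h1 : 0 < γ / (‖ι‖ ^ 2 + 1) := div_pos h.gamma_pos (by positivity)
    exact h1.trans_le (ge_of_tendsto' (hl.add_const ν) fun n => hu.le_energy_add h n)
  have hsub : ∀ ψ : ℕ → ℕ, Tendsto ψ atTop atTop → ∀ w, WeaklyConverges (u ∘ ψ) w →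
      Tendsto (u ∘ ψ) atTop (𝓝 w) ∧ w ∈ normalizedEigenvectors ι a l := fun ψ hψ w hw =>
    h.tendsto_of_weaklyConverges hι hd hl0 hless (fun n => hu.norm_eq _) (hl.comp hψ)
      (fun v => (hu.tendsto_residual h hι hS v).comp hψ) hw
  have hsubsub : ∀ ψ : ℕ → ℕ, Tendsto ψ atTop atTop → ∃ (φ : ℕ → ℕ),
      ∃ w ∈ normalizedEigenvectors ι a l, Tendsto (fun k => u (ψ (φ k))) atTop (𝓝 w) := by
    intro ψ hψ
    obtain ⟨w, φ, hφ, hw⟩ := exists_weaklyConverges_subseq (x := u ∘ ψ) (fun n => hC (ψ n))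
    have h1 := hsub (ψ ∘ φ) (hψ.comp hφ.tendsto_atTop) w hw
    exact ⟨φ, w, h1.2, h1.1⟩
  obtain ⟨-, w₀, hw₀, -⟩ := hsubsub id tendsto_id
  have haNorm : Continuous (aNorm ι a ν) := by
    unfold aNorm
    fun_prop
  refine ⟨l, hu.antitone h hι hS, hl, ⟨w₀, hw₀⟩, hless, ⟨C, hC⟩,
    fun φ hφ w hw => hsub φ hφ.tendsto_atTop w hw, ?_, fun hsimple => ?_⟩
  · refine tendsto_of_subseq_tendsto fun ψ hψ => ?_
    obtain ⟨φ, w, hw, hlim⟩ := hsubsub ψ hψ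
    refine ⟨φ, squeeze_zero (g := fun k => aNorm ι a ν (w - u (ψ (φ k))))
      (fun k => ?_) (fun k => ?_) ?_⟩
    · refine Real.sInf_nonneg ?_
      rintro _ ⟨v, -, rfl⟩
      exact Real.sqrt_nonneg _
    · refine csInf_le ⟨0, ?_⟩ ⟨w, hw, rfl⟩
      rintro _ ⟨v, -, rfl⟩
      exact Real.sqrt_nonneg _
    · have h1 : Tendsto (fun k => w - u (ψ (φ k))) atTop (𝓝 0) := by
        simpa using hlim.const_sub w
      have h2 := (haNorm.tendsto 0).comp h1
      have h3 : aNorm ι a ν 0 = 0 := by simp [aNorm]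
      rwa [h3] at h2
  · have hmin : Tendsto (fun n => min ‖u n - w₀‖ ‖u n + w₀‖) atTop (𝓝 0) := by
      refine tendsto_of_subseq_tendsto fun ψ hψ => ?_
      obtain ⟨φ, w, hw, hlim⟩ := hsubsub ψ hψ
      refine ⟨φ, ?_⟩
      have hcont : Continuous fun v : V => min ‖v - w₀‖ ‖v + w₀‖ := by fun_prop
      have h1 := (hcont.tendsto w).comp hlim
      rcases eq_or_eq_neg_of_finrank_eq_one hsimple hw₀ hw with rfl | rfl
      · simpa [Function.comp_def] using h1
      · simpa [Function.comp_def] using h1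
    rcases tendsto_of_tendsto_pair hw₀.2 hmin hor with h1 | h1
    · exact ⟨w₀, hw₀, h1⟩
    · exact ⟨-w₀, ⟨neg_mem hw₀.1, by simpa using hw₀.2⟩, h1⟩

end Step

/-! ### Normalization, orientation and Rayleigh quotients -/

section Algorithms

variable {V H : Type*} [NormedAddCommGroup V] [InnerProductSpace ℝ V]
  [NormedAddCommGroup H] [InnerProductSpace ℝ H]
  {ι : V →L[ℝ] H} {a : V →L[ℝ] V →L[ℝ] ℝ} {γ ν : ℝ} {S : Set V}

theorem norm_hNormalize (hι : Function.Injective ι) {v : V} (hv : v ≠ 0) :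
    ‖ι (hNormalize ι v)‖ = 1 := by
  have h1 : ι v ≠ 0 := fun h0 => hv (hι (by rw [h0, map_zero]))
  rw [hNormalize, map_smul, norm_smul, norm_inv, norm_norm, inv_mul_cancel₀ (norm_ne_zero_iff.mpr h1)]

theorem form_hNormalize (v : V) :
    a (hNormalize ι v) (hNormalize ι v) = a v v / ‖ι v‖ ^ 2 := by
  simp only [hNormalize, map_smul, smul_apply, smul_eq_mul]
  rw [← mul_assoc, ← mul_inv, ← sq, inv_mul_eq_div]

theorem norm_orient (u v : V) : ‖ι (orient ι u v)‖ = ‖ι v‖ := by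
  unfold orient
  split_ifs <;> simp

theorem form_orient (u v : V) : a (orient ι u v) (orient ι u v) = a v v := by
  unfold orient
  split_ifs <;> simp

theorem inner_orient_nonneg (u v : V) : 0 ≤ inner ℝ (ι u) (ι (orient ι u v)) := by
  unfold orient
  split_ifs with h
  · rw [map_neg, inner_neg_right]; linarith
  · exact (not_le.mp h).le

theorem rayleigh_of_ne_zero {v : V} (hv : v ≠ 0) :
    rayleigh ι a v = ((a v v / ‖ι v‖ ^ 2 : ℝ) : EReal) := if_neg hv

theorem rayleigh_smul {t : ℝ} (ht : t ≠ 0) (v : V) : rayleigh ι a (t • v) = rayleigh ι a v := by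
  by_cases hv : v = 0
  · simp [hv]
  rw [rayleigh_of_ne_zero hv, rayleigh_of_ne_zero (smul_ne_zero ht hv)]
  congr 1
  simp only [map_smul, smul_apply, norm_smul, mul_pow, Real.norm_eq_abs, sq_abs, smul_eq_mul]
  rw [← mul_assoc, ← sq, mul_div_mul_left _ _ (pow_ne_zero 2 ht)]

/-- The Rayleigh quotient attains its minimum on the range of a nonzero linear map from a finite
dimensional space, by compactness of the unit sphere of the range. -/
theorem exists_isMinOn_rayleigh (hι : Function.Injective ι) {E : Type*} [AddCommGroup E]
    [Module ℝ E] [FiniteDimensional ℝ E] (f : E →ₗ[ℝ] V) (hf : ∃ c, f c ≠ 0) :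
    ∃ c, IsMinOn (fun c => rayleigh ι a (f c)) Set.univ c := by
  set G : Submodule ℝ V := LinearMap.range f with hG
  have : ProperSpace G := FiniteDimensional.proper ℝ G
  obtain ⟨c₀, hc₀⟩ := hf
  have hunit : ∀ c, f c ≠ 0 → ∃ g ∈ Metric.sphere (0 : G) 1, (g : V) = ‖f c‖⁻¹ • f c := by
    intro c hc
    refine ⟨⟨‖f c‖⁻¹ • f c, G.smul_mem _ ⟨c, rfl⟩⟩, ?_, rfl⟩
    rw [mem_sphere_zero_iff_norm, Submodule.coe_norm, norm_smul, norm_inv, norm_norm,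
      inv_mul_cancel₀ (norm_ne_zero_iff.mpr hc)]
  have hne0 : ∀ g ∈ Metric.sphere (0 : G) 1, (g : V) ≠ 0 := by
    intro g hg h0
    have h1 : g = 0 := Subtype.ext h0
    rw [h1, mem_sphere_zero_iff_norm, norm_zero] at hg
    exact zero_ne_one hg
  have hcont : ContinuousOn (fun g : G => a (g : V) (g : V) / ‖ι (g : V)‖ ^ 2)
      (Metric.sphere (0 : G) 1) := by
    refine ContinuousOn.div (by fun_prop) (by fun_prop) fun g hg => ?_
    have h1 : ι (g : V) ≠ 0 := fun h0 => hne0 g hg (hι (by rw [h0, map_zero]))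
    exact pow_ne_zero 2 (norm_ne_zero_iff.mpr h1)
  obtain ⟨g₁, hg₁, -⟩ := hunit c₀ hc₀
  obtain ⟨g, hg, hmin⟩ := (isCompact_sphere (0 : G) 1).exists_isMinOn ⟨g₁, hg₁⟩ hcont
  obtain ⟨c, hc⟩ := g.2
  refine ⟨c, isMinOn_univ_iff.mpr fun c' => ?_⟩
  rw [hc]
  by_cases h0 : f c' = 0
  · rw [h0]
    exact le_top.trans_eq (if_pos rfl).symm
  obtain ⟨g', hg', hgc⟩ := hunit c' h0
  rw [← rayleigh_smul (inv_ne_zero (norm_ne_zero_iff.mpr h0)) (f c'), ← hgc,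
    rayleigh_of_ne_zero (hne0 g hg), rayleigh_of_ne_zero (hne0 g' hg'), EReal.coe_le_coe_iff]
  exact isMinOn_iff.mp hmin g' hg'

/-! ### Linear combinations of the selected elements -/

/-- `lincomb` as a linear map in the coefficients. -/
def lincombLinear (u₀ : V) (z : ℕ → V) (n : ℕ) : (Fin (n + 1) → ℝ) →ₗ[ℝ] V where
  toFun := lincomb u₀ z n
  map_add' c d := by
    simp only [lincomb, Pi.add_apply, add_smul, Finset.sum_add_distrib]
    abel
  map_smul' t c := by
    simp only [lincomb, Pi.smul_apply, smul_eq_mul, mul_smul, smul_add, Finset.smul_sum,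
      RingHom.id_apply]

theorem lincomb_smul (u₀ : V) (z : ℕ → V) (n : ℕ) (t : ℝ) (c : Fin (n + 1) → ℝ) :
    lincomb u₀ z n (t • c) = t • lincomb u₀ z n c :=
  (lincombLinear u₀ z n).map_smul t c

theorem lincomb_snoc (u₀ : V) (z : ℕ → V) (n : ℕ) (c : Fin (n + 1) → ℝ) (t : ℝ) :
    lincomb u₀ z (n + 1) (Fin.snoc (α := fun _ => ℝ) c t) =
      lincomb u₀ z n c + t • z (n + 1) := by
  have h0 : Fin.snoc (α := fun _ => ℝ) c t 0 = c 0 := Fin.snoc_castSucc (α := fun _ => ℝ) t c 0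
  have hk : ∀ k : Fin n, Fin.snoc (α := fun _ => ℝ) c t k.castSucc.succ = c k.succ := fun k =>
    Fin.snoc_castSucc (α := fun _ => ℝ) t c k.succ
  have hl : Fin.snoc (α := fun _ => ℝ) c t (Fin.last n).succ = t :=
    Fin.snoc_last (α := fun _ => ℝ) t c
  unfold lincomb
  rw [Fin.sum_univ_castSucc, h0, hl, ← add_assoc]
  simp only [hk, Fin.val_castSucc, Fin.val_last]

theorem exists_lincomb_eq_initial (u₀ : V) (z : ℕ → V) (n : ℕ) :
    ∃ c, lincomb u₀ z n c = u₀ := by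
  refine ⟨Fin.cons 1 0, ?_⟩
  simp [lincomb]

theorem lincomb_ne_zero_of_isRayleighMin {u₀ : V} (hu₀ : u₀ ≠ 0) {z : ℕ → V} {n : ℕ}
    {c : Fin (n + 1) → ℝ} (hc : IsRayleighMin ι a u₀ z n c) : lincomb u₀ z n c ≠ 0 := by
  intro h0
  obtain ⟨c₁, hc₁⟩ := exists_lincomb_eq_initial u₀ z n
  have h1 : rayleigh ι a (lincomb u₀ z n c) ≤ rayleigh ι a (lincomb u₀ z n c₁) :=
    isMinOn_univ_iff.mp hc c₁
  rw [hc₁, rayleigh_of_ne_zero hu₀, h0, rayleigh, if_pos rfl, top_le_iff] at h1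
  exact EReal.coe_ne_top _ h1

theorem orient_hNormalize_lincomb (u₀ : V) (z : ℕ → V) (n : ℕ) (c : Fin (n + 1) → ℝ) (u : V) :
    ∃ d, orient ι u (hNormalize ι (lincomb u₀ z n c)) = lincomb u₀ z n d := by
  unfold orient hNormalize
  split_ifs
  · exact ⟨(-‖ι (lincomb u₀ z n c)‖⁻¹) • c, by rw [lincomb_smul, neg_smul]⟩
  · exact ⟨‖ι (lincomb u₀ z n c)‖⁻¹ • c, by rw [lincomb_smul]⟩

/-! ### The iterates of the two algorithms -/

theorem IsPReGAUpTo.norm_eq {u₀ : V} {N : ℕ} {z u : ℕ → V}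
    (hrun : IsPReGAUpTo ι a ν S u₀ N z u) (h : IsGardingForm ι a γ ν)
    (hι : Function.Injective ι) (hS : IsDictionary S) (hu₀ : ‖ι u₀‖ = 1) {n : ℕ} (hn : n ≤ N) :
    ‖ι (u n)‖ = 1 := by
  induction n with
  | zero => rw [hrun.1, hu₀]
  | succ n ih =>
    have h1 := hrun.2 n (by omega)
    rw [h1.2]
    exact norm_hNormalize hι (h.add_ne_zero_of_isResidualMin hS.smul_mem (ih (by omega)) h1.1)

theorem IsOReGAUpTo.norm_eq {u₀ : V} {N : ℕ} {z u : ℕ → V}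
    (hrun : IsOReGAUpTo ι a ν S u₀ N z u) (hι : Function.Injective ι) (hu₀ : ‖ι u₀‖ = 1)
    {n : ℕ} (hn : n ≤ N) : ‖ι (u n)‖ = 1 := by
  cases n with
  | zero => rw [hrun.1, hu₀]
  | succ n =>
    obtain ⟨-, c, hc, hcu⟩ := hrun.2 n (by omega)
    have hu0 : u₀ ≠ 0 := by rintro rfl; simp at hu₀
    rw [hcu, norm_orient, norm_hNormalize hι (lincomb_ne_zero_of_isRayleighMin hu0 hc)]

theorem IsOReGAUpTo.exists_eq_lincomb {u₀ : V} {N : ℕ} {z u : ℕ → V}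
    (hrun : IsOReGAUpTo ι a ν S u₀ N z u) {n : ℕ} (hn : n ≤ N) :
    ∃ c, u n = lincomb u₀ z n c := by
  cases n with
  | zero =>
    obtain ⟨c, hc⟩ := exists_lincomb_eq_initial u₀ z 0
    exact ⟨c, by rw [hrun.1, hc]⟩
  | succ n =>
    obtain ⟨-, c, -, hcu⟩ := hrun.2 n (by omega)
    rw [hcu]
    exact orient_hNormalize_lincomb _ _ _ _ _

theorem pReGAWellDefined [CompleteSpace V] [TopologicalSpace.SeparableSpace V]
    (h : IsGardingForm ι a γ ν) (hι : Function.Injective ι) (hS : IsDictionary S) {u₀ : V}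
    (hu₀ : ‖ι u₀‖ = 1) : PReGAWellDefined ι a ν S u₀ := fun _ _ u hrun =>
  ⟨h.exists_isResidualMin hS (u _), fun _ hx =>
    h.add_ne_zero_of_isResidualMin hS.smul_mem (hrun.norm_eq h hι hS hu₀ le_rfl) hx⟩

theorem oReGAWellDefined [CompleteSpace V] [TopologicalSpace.SeparableSpace V]
    (h : IsGardingForm ι a γ ν) (hι : Function.Injective ι) (hS : IsDictionary S) {u₀ : V}
    (hu₀ : ‖ι u₀‖ = 1) : OReGAWellDefined ι a ν S u₀ := by
  intro N z u _
  have hu0 : u₀ ≠ 0 := by rintro rfl; simp at hu₀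
  refine ⟨h.exists_isResidualMin hS (u N), fun _ =>
    ⟨?_, fun c hc => lincomb_ne_zero_of_isRayleighMin hu0 hc⟩⟩
  obtain ⟨c₁, hc₁⟩ := exists_lincomb_eq_initial u₀ z (N + 1)
  exact exists_isMinOn_rayleigh hι (lincombLinear u₀ z (N + 1)) ⟨c₁, fun h0 => hu0 (hc₁ ▸ h0)⟩

theorem IsPReGAUpTo.isResidualDescent {u₀ : V} {z u : ℕ → V}
    (hrun : ∀ N, IsPReGAUpTo ι a ν S u₀ N z u) (h : IsGardingForm ι a γ ν)
    (hι : Function.Injective ι) (hS : IsDictionary S) (hu₀ : ‖ι u₀‖ = 1) :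
    IsResidualDescent ι a ν S z u where
  norm_eq n := (hrun n).norm_eq h hι hS hu₀ le_rfl
  isMin n := ((hrun (n + 1)).2 n (Nat.lt_succ_self n)).1
  descent n := by
    have h1 := (hrun (n + 1)).2 n (Nat.lt_succ_self n)
    have h2 := h.add_ne_zero_of_isResidualMin hS.smul_mem
      ((hrun n).norm_eq h hι hS hu₀ le_rfl) h1.1
    have h3 : ι (u n + z (n + 1)) ≠ 0 := fun h0 => h2 (hι (by rw [h0, map_zero]))
    rw [h1.2, form_hNormalize, div_mul_cancel₀ _ (pow_ne_zero 2 (norm_ne_zero_iff.mpr h3))]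

theorem IsOReGAUpTo.isResidualDescent {u₀ : V} {z u : ℕ → V}
    (hrun : ∀ N, IsOReGAUpTo ι a ν S u₀ N z u) (h : IsGardingForm ι a γ ν)
    (hι : Function.Injective ι) (hS : IsDictionary S) (hu₀ : ‖ι u₀‖ = 1) :
    IsResidualDescent ι a ν S z u where
  norm_eq n := (hrun n).norm_eq hι hu₀ le_rfl
  isMin n := ((hrun (n + 1)).2 n (Nat.lt_succ_self n)).1
  descent n := by
    obtain ⟨hmin, c, hc, hcu⟩ := (hrun (n + 1)).2 n (Nat.lt_succ_self n)
    have hu0 : u₀ ≠ 0 := by rintro rfl; simp at hu₀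
    have hc0 := lincomb_ne_zero_of_isRayleighMin hu0 hc
    have h2 := h.add_ne_zero_of_isResidualMin hS.smul_mem
      ((hrun n).norm_eq hι hu₀ le_rfl) hmin
    have h3 : ι (u n + z (n + 1)) ≠ 0 := fun h0 => h2 (hι (by rw [h0, map_zero]))
    -- `u n + z (n + 1)` is a competitor in the Rayleigh minimization
    obtain ⟨d, hd⟩ := (hrun n).exists_eq_lincomb le_rfl
    have h4 : lincomb u₀ z (n + 1) (Fin.snoc (α := fun _ => ℝ) d 1) = u n + z (n + 1) := by
      rw [lincomb_snoc, ← hd, one_smul]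
    have h5 : rayleigh ι a (lincomb u₀ z (n + 1) c) ≤
        rayleigh ι a (lincomb u₀ z (n + 1) (Fin.snoc (α := fun _ => ℝ) d 1)) :=
      isMinOn_univ_iff.mp hc _
    rw [h4, rayleigh_of_ne_zero hc0, rayleigh_of_ne_zero h2, EReal.coe_le_coe_iff] at h5
    rw [hcu, form_orient, form_hNormalize]
    have h6 : 0 < ‖ι (u n + z (n + 1))‖ ^ 2 := by positivity
    exact (le_div_iff₀ h6).mp h5

/-- Successive PReGA iterates are eventually not opposite, since the corrections tend to `0`. -/
theorem IsPReGAUpTo.eventually_inner_nonneg {u₀ : V} {z u : ℕ → V}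
    (hrun : ∀ N, IsPReGAUpTo ι a ν S u₀ N z u) (h : IsGardingForm ι a γ ν)
    (hι : Function.Injective ι) (hS : IsDictionary S) (hu₀ : ‖ι u₀‖ = 1) :
    ∀ᶠ n in atTop, 0 ≤ inner ℝ (ι (u n)) (ι (u (n + 1))) := by
  have hu := IsPReGAUpTo.isResidualDescent hrun h hι hS hu₀
  have h1 := (hu.tendsto_correction h hι hS).const_mul ‖ι‖
  rw [mul_zero] at h1
  filter_upwards [h1.eventually_lt_const one_pos] with n hn
  rw [((hrun (n + 1)).2 n (Nat.lt_succ_self n)).2, hNormalize, map_smul, real_inner_smul_right,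
    map_add, inner_add_right, real_inner_self_eq_norm_sq, hu.norm_eq]
  refine mul_nonneg (by positivity) ?_
  have h2 := (abs_le.mp (abs_real_inner_le_norm (ι (u n)) (ι (z (n + 1))))).1
  rw [hu.norm_eq] at h2
  linarith [ι.le_opNorm (z (n + 1))]

end Algorithms

end GreedyEigen


theorem mainTheorem2
    {V H : Type*}
    [NormedAddCommGroup V] [InnerProductSpace ℝ V] [CompleteSpace V]
    [TopologicalSpace.SeparableSpace V]
    [NormedAddCommGroup H] [InnerProductSpace ℝ H] [CompleteSpace H]
    [TopologicalSpace.SeparableSpace H]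
    (ι : V →L[ℝ] H) (hι : Function.Injective ι) (hdense : DenseRange ι)
    (S : Set V) (hS : GreedyEigen.IsDictionary S)
    (a : V →L[ℝ] V →L[ℝ] ℝ) (hsymm : ∀ v w, a v w = a w v)
    (γ ν : ℝ) (hγ : 0 < γ) (hν : 0 < ν)
    (hA : ∀ v, γ * ‖v‖ ^ 2 - ν * ‖ι v‖ ^ 2 ≤ a v v)
    (hgap : GreedyEigen.minSpec (GreedyEigen.opSpec (GreedyEigen.formOperator ι a)) <
      GreedyEigen.minSpec (GreedyEigen.opEssSpec (GreedyEigen.formOperator ι a)))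
    (u₀ : V) (hu₀ : ‖ι u₀‖ = 1)
    (hlow : GreedyEigen.minSpec (GreedyEigen.opSpec (GreedyEigen.formOperator ι a)) ≤
      ((a u₀ u₀ : ℝ) : EReal))
    (hhigh : ((a u₀ u₀ : ℝ) : EReal) <
      GreedyEigen.minSpec (GreedyEigen.opEssSpec (GreedyEigen.formOperator ι a))) :
    GreedyEigen.PReGAWellDefined ι a ν S u₀ ∧
    GreedyEigen.OReGAWellDefined ι a ν S u₀ ∧
    (∀ u : ℕ → V, GreedyEigen.IsPReGASequence ι a ν S u₀ u →
      ∃ l : ℝ, GreedyEigen.ConvergesToEigenpair ι a ν u l) ∧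
    (∀ u : ℕ → V, GreedyEigen.IsOReGASequence ι a ν S u₀ u →
      ∃ l : ℝ, GreedyEigen.ConvergesToEigenpair ι a ν u l) := by
  have h : GreedyEigen.IsGardingForm ι a γ ν := ⟨hsymm, hγ, hA⟩
  refine ⟨GreedyEigen.pReGAWellDefined h hι hS hu₀, GreedyEigen.oReGAWellDefined h hι hS hu₀,
    ?_, ?_⟩
  · rintro u ⟨z, hrun⟩
    refine (GreedyEigen.IsPReGAUpTo.isResidualDescent hrun h hι hS hu₀).convergesToEigenpair h hι
      hdense hS ?_ (GreedyEigen.IsPReGAUpTo.eventually_inner_nonneg hrun h hι hS hu₀)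
    rwa [(hrun 0).1]
  · rintro u ⟨z, hrun⟩
    refine (GreedyEigen.IsOReGAUpTo.isResidualDescent hrun h hι hS hu₀).convergesToEigenpair h hι
      hdense hS ?_ (Eventually.of_forall fun n => ?_)
    · rwa [(hrun 0).1]
    · obtain ⟨-, c, -, hcu⟩ := (hrun (n + 1)).2 n (Nat.lt_succ_self n)
      rw [hcu]
      exact GreedyEigen.inner_orient_nonneg _ _
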